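/- Let $G$ be a finite group. A set $\delta$ of proper subgroups of $G$ is called a covering of $G$ if $G=\bigcup_{L\in\delta}L$ and no member of $\delta$ is contained in a different member of $\delta$. The group $G$ is called $(\ast\ast)$-coverable if there are two proper subgroups $H,K<G$ such that $\delta=\{H^g,K^g : g\in G\}$, where $H^g=g^{-1}Hg$, is a covering of $G$. (For a finite group the condition on inclusions follows automatically once $H,K$ are proper and $G=\bigcup_{g\in G}H^g\cup\bigcup_{g\in G}K^g$.) **Theorem.** For every natural number $n$, the alternating group $A_n$ is $(\ast\ast)$-coverable if and only if $4\le n\le 8$. -/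

import Mathlib

/-- A set `δ` of subgroups of `G` is a covering of `G` if its members are proper subgroups, `G` is
their set-theoretical union, and there are no inclusions between distinct members. -/
structure IsGroupCovering {G : Type*} [Group G] (δ : Set (Subgroup G)) : Prop where
  proper : ∀ L ∈ δ, L ≠ ⊤
  union_eq : (⋃ L ∈ δ, (L : Set G)) = Set.univ
  not_le : ∀ L ∈ δ, ∀ M ∈ δ, L ≠ M → ¬ L ≤ M

/-- The set of all `G`-conjugates `g H g⁻¹` of the subgroup `H`. -/
def conjugateSubgroups {G : Type*} [Group G] (H : Subgroup G) : Set (Subgroup G) :=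
  {L | ∃ g : G, L = H.map (MulAut.conj g).toMonoidHom}

/-- `G` is (∗∗)-coverable: there are proper subgroups `H`, `K` of `G` such that the `G`-conjugates
of `H` and the `G`-conjugates of `K` together form a covering of `G`. -/
def IsStarStarCoverable (G : Type*) [Group G] : Prop :=
  ∃ H K : Subgroup G, H ≠ ⊤ ∧ K ≠ ⊤ ∧
    IsGroupCovering (conjugateSubgroups H ∪ conjugateSubgroups K)

/-!
A proper subgroup `H` of `A_n` restricts the cycle types of its elements in one of three ways. If
`H` is intransitive, then some fixed `k` with `0 < k < n` is a sum of cycle lengths of every element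
of `H`. If `H` is imprimitive with blocks of size `d`, then `d` divides `n - q` whenever a power of
an element of `H` is a `q`-cycle with `d ≤ q`. If `H` is primitive, then by Jordan's theorem it
contains no cycle of prime length at most `n - 3`. For `n ≥ 9`, comparing these restrictions for `H`
and `K` on even cycle types with at most four cycles rules out all pairs, except that in degrees
`9`, `10` and `12` a primitive group and an intransitive group survive; there the primitive group is
shown to contain a cycle of prime length after all.

For `4 ≤ n ≤ 8` the stabilizer of a small set of points and a group preserving a geometric structure
(a partition into pairs, an affine or projective space) meet all classes of even permutations. For
`n ≤ 3` the group `A_n` has no proper nontrivial subgroups.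
-/

open Equiv.Perm MulAction
open scoped Pointwise commutatorElement

section Sylow

variable {G : Type*} [Group G] [Finite G] {p : ℕ} [Fact p.Prime]

theorem exists_conj_mem_sylow (P : Sylow p G) {x : G} (hx : IsPGroup p (Subgroup.zpowers x)) :
    ∃ g : G, g * x * g⁻¹ ∈ P := by
  obtain ⟨Q, hQ⟩ := hx.exists_le_sylow
  obtain ⟨g, rfl⟩ := exists_smul_eq G Q P
  exact ⟨g, Subgroup.smul_mem_pointwise_smul x (MulAut.conj g) _ (hQ (Subgroup.mem_zpowers x))⟩

theorem exists_conj_mem_zpowers_of_not_sq_dvd_card (hG : ¬ p ^ 2 ∣ Nat.card G) {c x : G}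
    (hc : orderOf c = p) (hx : orderOf x = p) : ∃ g : G, g * x * g⁻¹ ∈ Subgroup.zpowers c := by
  have hp : p.Prime := Fact.out
  have hG₀ : Nat.card G ≠ 0 := Nat.card_pos.ne'
  have hfac : (Nat.card G).factorization p = 1 := by
    have h₁ := (hp.dvd_iff_one_le_factorization hG₀).1 (hc ▸ orderOf_dvd_natCard c)
    have h₂ := mt (hp.pow_dvd_iff_le_factorization hG₀).2 hG
    omega
  exact exists_conj_mem_sylow
    (Sylow.ofCard (Subgroup.zpowers c) (by rw [hfac, pow_one, Nat.card_zpowers, hc]))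
    (IsPGroup.of_card (n := 1) (by rw [Nat.card_zpowers, hx, pow_one]))

end Sylow

theorem commute_commutatorElement_of_conj_mem_zpowers {G : Type*} [Group G] {c g h : G}
    (hg : g * c * g⁻¹ ∈ Subgroup.zpowers c) (hh : h * c * h⁻¹ ∈ Subgroup.zpowers c) :
    Commute ⁅g⁻¹, h⁻¹⁆ c := by
  obtain ⟨i, hi⟩ := Subgroup.mem_zpowers_iff.1 hg
  obtain ⟨j, hj⟩ := Subgroup.mem_zpowers_iff.1 hh
  have hgh : (g * h) * c * (g * h)⁻¹ = c ^ (i * j) := by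
    rw [zpow_mul, hi, conj_zpow, hj]
    group
  have hhg : (h * g) * c * (h * g)⁻¹ = c ^ (i * j) := by
    rw [mul_comm i j, zpow_mul, hj, conj_zpow, hi]
    group
  have hconj : (g * h) * c = (h * g) * c * (h * g)⁻¹ * (g * h) := by
    rw [hhg, ← hgh, inv_mul_cancel_right]
  calc ⁅g⁻¹, h⁻¹⁆ * c = (h * g)⁻¹ * ((g * h) * c) := by rw [commutatorElement_def]; group
    _ = c * ⁅g⁻¹, h⁻¹⁆ := by rw [hconj, commutatorElement_def]; group

section Jordan

variable {α : Type*} {G : Subgroup (Equiv.Perm α)}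

theorem exists_mem_eqOn_of_isMultiplyPretransitive {s : Finset α}
    (hG : IsMultiplyPretransitive G α s.card) (π : Equiv.Perm α) :
    ∃ g ∈ G, Set.EqOn g π s := by
  let e : Fin s.card ↪ α := s.equivFin.symm.toEmbedding.trans (Function.Embedding.subtype _)
  obtain ⟨g, hg⟩ := hG.exists_smul_eq e (e.trans π.toEmbedding)
  refine ⟨g, g.2, fun x hx => ?_⟩
  simpa [e] using! DFunLike.congr_fun hg (s.equivFin ⟨x, hx⟩)

variable [Fintype α] [DecidableEq α]

theorem card_dvd_factorial_of_support_subset {s : Finset α} (hG : ∀ g ∈ G, g.support ⊆ s) :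
    Nat.card G ∣ s.card.factorial := by
  have hle : G ≤ (ofSubtype (p := (· ∈ s))).range := fun g hg =>
    mem_range_ofSubtype_iff.2 (by exact_mod_cast hG g hg)
  have hdvd := Subgroup.card_dvd_of_le hle
  rwa [← Nat.card_congr (MonoidHom.ofInjective ofSubtype_injective).toEquiv, Nat.card_perm,
    Nat.card_eq_finsetCard] at hdvd

theorem not_sq_dvd_card_of_support_subset {p : ℕ} (hp : p.Prime) {s : Finset α} (hs : s.card = p)
    (hG : ∀ g ∈ G, g.support ⊆ s) : ¬ p ^ 2 ∣ Nat.card G := by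
  intro h
  have hdvd := h.trans (card_dvd_factorial_of_support_subset hG)
  rw [hs, ← Nat.mul_factorial_pred hp.ne_zero, pow_two] at hdvd
  have hle := hp.dvd_factorial.1 (Nat.dvd_of_mul_dvd_mul_left hp.pos hdvd)
  have := hp.pos
  omega

theorem mem_of_commute_of_eqOn_compl_support {c u π : Equiv.Perm α} (hc : c.IsCycle)
    (hcG : c ∈ G) (huG : u ∈ G) (huc : Commute u c) (hπ : π.Disjoint c)
    (hu : ∀ x ∉ c.support, u x = π x) : π ∈ G := by
  obtain ⟨hmaps, k, hk⟩ := hc.commute_iff.1 huc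
  suffices (c ^ k)⁻¹ * u = π from this ▸ G.mul_mem (G.inv_mem (G.zpow_mem hcG k)) huG
  ext x
  rw [mul_apply, inv_eq_iff_eq]
  by_cases hx : x ∈ c.support
  · rw [(hπ x).resolve_right (mem_support.1 hx)]
    exact (ofSubtype_subtypePerm_of_mem hmaps hx).symm.trans (DFunLike.congr_fun hk x).symm
  · have hux : u x ∉ c.support := fun h => hx ((hmaps x).1 h)
    rw [← hu x hx, zpow_apply_eq_self_of_apply_eq_self (notMem_support.1 hux)]

theorem isMultiplyPretransitive_of_prime_cycle_mem (hG : IsPreprimitive G α) {c : Equiv.Perm α}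
    (hc : c.IsCycle) (hp : c.support.card.Prime) (hlt : c.support.card < Fintype.card α)
    (hcG : c ∈ G) : IsMultiplyPretransitive G α c.supportᶜ.card := by
  have hp₂ := hp.two_le
  have := isPretransitive_of_isCycle_mem hc hcG
  have hprim : IsPreprimitive (fixingSubgroup G (c.support : Set α)ᶜ)
      (SubMulAction.ofFixingSubgroup G (c.support : Set α)ᶜ) := by
    apply IsPreprimitive.of_prime_card
    convert! hp
    rw [← Nat.card_eq_finsetCard]
    exact Nat.card_congr (Equiv.subtypeEquivRight fun x => by
      rw [SubMulAction.mem_ofFixingSubgroup_iff]; simp)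
  have hmulti := hG.isMultiplyPreprimitive (s := (c.support : Set α)ᶜ)
    (n := Fintype.card α - c.support.card - 1)
    (by rw [← Finset.coe_compl, Set.ncard_coe_finset, Finset.card_compl]; omega)
    (by rw [Nat.card_eq_fintype_card]; omega) hprim
  have := hmulti.isMultiplyPretransitive
  refine isMultiplyPretransitive_of_le (n := Fintype.card α - c.support.card - 1 + 2)
    (by rw [Finset.card_compl]; omega) ?_
  rw [Nat.card_eq_fintype_card]
  omega

theorem inv_apply_eq_of_eqOn_compl_support {c g π : Equiv.Perm α} (hπ : π.Disjoint c)
    (hg : ∀ x ∉ c.support, g x = π x) {x : α} (hx : x ∉ c.support) : g⁻¹ x = π⁻¹ x := by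
  rw [inv_eq_iff_eq, hg _ (mt (mem_support_iff_of_commute hπ.inv_left.commute x).1 hx)]
  exact (π.apply_symm_apply x).symm

/-- The Frattini argument: `c` generates a Sylow subgroup of the group of those elements of `G` that
fix every fixed point of `c`. -/
theorem exists_mem_eqOn_compl_support_of_prime_cycle_mem (hG : IsPreprimitive G α)
    {c : Equiv.Perm α} (hc : c.IsCycle) (hp : c.support.card.Prime)
    (hlt : c.support.card < Fintype.card α) (hcG : c ∈ G) {π : Equiv.Perm α}
    (hπ : π.Disjoint c) :
    ∃ g ∈ G, (∀ x ∉ c.support, g x = π x) ∧ g * c * g⁻¹ ∈ Subgroup.zpowers c := by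
  obtain ⟨g, hgG, hg⟩ := exists_mem_eqOn_of_isMultiplyPretransitive
    (isMultiplyPretransitive_of_prime_cycle_mem hG hc hp hlt hcG) π
  replace hg : ∀ x ∉ c.support, g x = π x := fun x hx => hg (by simpa using hx)
  let T : Subgroup (Equiv.Perm α) := G ⊓ fixingSubgroup (Equiv.Perm α) {x | x ∉ c.support}
  have mem_T : ∀ {t}, t ∈ T ↔ t ∈ G ∧ ∀ x ∉ c.support, t x = x := by
    simp [T, mem_fixingSubgroup_iff]
  have hcT : c ∈ T := mem_T.2 ⟨hcG, fun x hx => notMem_support.1 hx⟩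
  have hgcT : g * c * g⁻¹ ∈ T := by
    refine mem_T.2 ⟨G.mul_mem (G.mul_mem hgG hcG) (G.inv_mem hgG), fun x hx => ?_⟩
    have hfix : c (g⁻¹ x) = g⁻¹ x := by
      rw [inv_apply_eq_of_eqOn_compl_support hπ hg hx, ← notMem_support]
      exact mt (mem_support_iff_of_commute hπ.inv_left.commute x).1 hx
    rw [mul_apply, mul_apply, hfix]
    exact g.apply_symm_apply x
  have hT : ¬ c.support.card ^ 2 ∣ Nat.card T :=
    not_sq_dvd_card_of_support_subset hp rfl fun t ht x hx => by
      by_contra hxc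
      exact mem_support.1 hx ((mem_T.1 ht).2 x hxc)
  have : Fact c.support.card.Prime := ⟨hp⟩
  obtain ⟨t, k, hk⟩ := exists_conj_mem_zpowers_of_not_sq_dvd_card hT
    (c := ⟨c, hcT⟩) (x := ⟨g * c * g⁻¹, hgcT⟩) (by rw [Subgroup.orderOf_mk, hc.orderOf])
    (by rw [Subgroup.orderOf_mk, ← hc.orderOf]; exact (MulAut.conj g).orderOf_eq c)
  refine ⟨t * g, G.mul_mem (mem_T.1 t.2).1 hgG, fun x hx => ?_, k, ?_⟩
  · rw [mul_apply, hg x hx, (mem_T.1 t.2).2]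
    exact mt (mem_support_iff_of_commute hπ.commute x).1 hx
  · refine (congrArg Subtype.val hk).trans ?_
    simp [mul_assoc]

theorem commutatorElement_mem_of_prime_cycle_mem (hG : IsPreprimitive G α) {c : Equiv.Perm α}
    (hc : c.IsCycle) (hp : c.support.card.Prime) (hlt : c.support.card < Fintype.card α)
    (hcG : c ∈ G) {σ τ : Equiv.Perm α} (hσ : σ.Disjoint c) (hτ : τ.Disjoint c) :
    ⁅σ, τ⁆ ∈ G := by
  obtain ⟨g, hgG, hg, hgc⟩ :=
    exists_mem_eqOn_compl_support_of_prime_cycle_mem hG hc hp hlt hcG hσ.inv_left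
  obtain ⟨h, hhG, hh, hhc⟩ :=
    exists_mem_eqOn_compl_support_of_prime_cycle_mem hG hc hp hlt hcG hτ.inv_left
  refine mem_of_commute_of_eqOn_compl_support (u := ⁅g⁻¹, h⁻¹⁆) hc hcG ?_
    (commute_commutatorElement_of_conj_mem_zpowers hgc hhc) ?_ fun x hx => ?_
  · exact G.mul_mem (G.mul_mem (G.mul_mem (G.inv_mem hgG) (G.inv_mem hhG))
      (G.inv_mem (G.inv_mem hgG))) (G.inv_mem (G.inv_mem hhG))
  · exact ((hσ.mul_left hτ).mul_left hσ.inv_left).mul_left hτ.inv_left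
  · have hσc : ∀ {y}, y ∉ c.support → σ⁻¹ y ∉ c.support :=
      mt (mem_support_iff_of_commute hσ.inv_left.commute _).1
    have hτc : ∀ {y}, y ∉ c.support → τ⁻¹ y ∉ c.support :=
      mt (mem_support_iff_of_commute hτ.inv_left.commute _).1
    have hτc' := mt (mem_support_iff_of_commute hτ.commute (σ⁻¹ (τ⁻¹ x))).1 (hσc (hτc hx))
    simp only [commutatorElement_def, mul_apply, inv_inv]
    rw [hh x hx, hg _ (hτc hx),
      inv_apply_eq_of_eqOn_compl_support hτ.inv_left hh (hσc (hτc hx)), inv_inv,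
      inv_apply_eq_of_eqOn_compl_support hσ.inv_left hg hτc', inv_inv]

theorem alternatingGroup_le_of_isPreprimitive_of_prime_cycle_mem (hG : IsPreprimitive G α)
    {c : Equiv.Perm α} (hc : c.IsCycle) (hp : c.support.card.Prime)
    (hcard : c.support.card + 3 ≤ Fintype.card α) (hcG : c ∈ G) : alternatingGroup α ≤ G := by
  obtain ⟨a, b, d, ha, hb, hd, hab, had, hbd⟩ : ∃ a b d, a ∈ c.supportᶜ ∧ b ∈ c.supportᶜ ∧
      d ∈ c.supportᶜ ∧ a ≠ b ∧ a ≠ d ∧ b ≠ d :=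
    Finset.two_lt_card_iff.1 (by rw [Finset.card_compl]; omega)
  rw [Finset.mem_compl] at ha hb hd
  have hswap : ∀ {u v : α}, u ∉ c.support → v ∉ c.support → u ≠ v →
      (Equiv.swap u v).Disjoint c := by
    intro u v hu hv huv
    simp [disjoint_iff_disjoint_support, support_swap huv, hu, hv]
  have hthree : IsThreeCycle ⁅Equiv.swap a b, Equiv.swap b d⁆ := by
    rw [commutatorElement_def, Equiv.swap_inv, Equiv.swap_inv, mul_assoc, Equiv.swap_comm a b]
    exact (isThreeCycle_swap_mul_swap_same hab.symm hbd had).isThreeCycle_sq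
  exact alternatingGroup_le_of_isPreprimitive_of_isThreeCycle_mem hG hthree
    (commutatorElement_mem_of_prime_cycle_mem hG hc hp (by omega) hcG (hswap ha hb hab)
      (hswap hb hd hbd))

end Jordan

section Blocks

variable {G α : Type*} [Group G] [MulAction G α]

theorem ncard_dvd_card_of_isBlock [IsPretransitive G α] {B : Set α} (hB : IsBlock G B)
    (hne : B.Nonempty) {s : Finset α} (hs : ∀ g : G, ∀ x ∈ s, x ∈ g • B → g • B ⊆ s) :
    B.ncard ∣ s.card := by
  classical
  obtain ⟨b, hb⟩ := hne
  choose g hg using exists_smul_eq G b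
  have mem_self : ∀ x, x ∈ g x • B := fun x => ⟨b, hb, hg x⟩
  have eq_of_mem : ∀ {x y}, y ∈ g x • B → g y • B = g x • B := fun {x y} hy => by
    by_contra h
    exact Set.disjoint_left.1 (hB h) (mem_self y) hy
  rw [Finset.card_eq_sum_card_image (fun x => g x • B)]
  refine Finset.dvd_sum fun C hC => dvd_of_eq ?_
  obtain ⟨x, hx, rfl⟩ := Finset.mem_image.1 hC
  rw [← Set.ncard_smul_set (g x) B, ← Set.ncard_coe_finset]
  congr 1
  ext y
  rw [Finset.mem_coe, Finset.mem_filter]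
  exact ⟨fun hy => ⟨hs _ x hx (mem_self x) hy, eq_of_mem hy⟩, fun hy => hy.2 ▸ mem_self y⟩

variable {H : Subgroup (Equiv.Perm α)} [Fintype α] [DecidableEq α]

theorem disjoint_support_of_isBlock {B : Set α} (hB : IsBlock H B) {c : Equiv.Perm α}
    (hcH : c ∈ H) (hc : c.IsCycle) (hcard : B.ncard ≤ c.support.card) {x : α}
    (hx : x ∉ c.support) (hxB : x ∈ B) : Disjoint B c.support := by
  refine Set.disjoint_left.2 fun y hyB hy => hcard.not_gt ?_
  have hfix : ∀ i : ℤ, (⟨c ^ i, H.zpow_mem hcH i⟩ : H) • B = B := fun i =>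
    hB.smul_eq_of_mem hxB (by
      change (c ^ i) x ∈ B
      rwa [zpow_apply_eq_self_of_apply_eq_self (notMem_support.1 hx)])
  have hsub : (↑(insert x c.support) : Set α) ⊆ B := by
    rw [Finset.coe_insert, Set.insert_subset_iff]
    refine ⟨hxB, fun z hz => ?_⟩
    obtain ⟨i, rfl⟩ := hc.exists_zpow_eq (mem_support.1 hy) (mem_support.1 hz)
    rw [← hfix i]
    exact ⟨y, hyB, rfl⟩
  calc c.support.card < (insert x c.support).card := by
        rw [Finset.card_insert_of_notMem hx]; exact Nat.lt_succ_self _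
    _ = (↑(insert x c.support) : Set α).ncard := (Set.ncard_coe_finset _).symm
    _ ≤ B.ncard := Set.ncard_le_ncard hsub

theorem ncard_dvd_card_compl_support_of_isBlock [IsPretransitive H α] {B : Set α}
    (hB : IsBlock H B) (hne : B.Nonempty) {c : Equiv.Perm α} (hcH : c ∈ H) (hc : c.IsCycle)
    (hcard : B.ncard ≤ c.support.card) : B.ncard ∣ c.supportᶜ.card := by
  refine ncard_dvd_card_of_isBlock hB hne fun g x hx hxg => ?_
  rw [Finset.coe_compl, Set.subset_compl_iff_disjoint_right]
  exact disjoint_support_of_isBlock (hB.translate g) hcH hc (by rwa [Set.ncard_smul_set])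
    (Finset.mem_compl.1 hx) hxg

end Blocks

section CycleTypes

variable {α : Type*} [Fintype α] [DecidableEq α]

/-- The cycle types of the elements of a permutation group, as multisets of cycle lengths in which
each fixed point counts as a cycle of length one. -/
def cycleTypes (H : Subgroup (Equiv.Perm α)) : Set (Multiset ℕ) :=
  {l | ∃ σ ∈ H, σ.partition.parts = l}

theorem parts_partition_mem_cycleTypes_of_conj_mem {H : Subgroup (Equiv.Perm α)}
    {g σ : Equiv.Perm α} (h : g * σ * g⁻¹ ∈ H) : σ.partition.parts ∈ cycleTypes H :=
  ⟨_, h, by rw [partition_eq_of_isConj.1 (isConj_iff.2 ⟨g, rfl⟩ : IsConj σ (g * σ * g⁻¹))]⟩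

theorem exists_mem_alternatingGroup_parts_eq {l : Multiset ℕ} (hpos : ∀ x ∈ l, 0 < x)
    (hsum : l.sum = Fintype.card α) (heven : Even (Fintype.card α + l.card)) :
    ∃ σ ∈ alternatingGroup α, σ.partition.parts = l := by
  set m := l.filter (2 ≤ ·)
  set r := (l.filter fun x => ¬ 2 ≤ x).card
  have hl : m + Multiset.replicate r 1 = l := by
    rw [← Multiset.filter_add_not (2 ≤ ·) l]
    refine congrArg (m + ·) (Multiset.eq_replicate.2 ⟨rfl, fun b hb => ?_⟩).symm
    have := hpos b (Multiset.mem_of_mem_filter hb)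
    have := Multiset.of_mem_filter hb
    omega
  have hmsum : m.sum + r = Fintype.card α := by rw [← hsum, ← hl]; simp
  obtain ⟨σ, hσ⟩ := (exists_with_cycleType_iff α (m := m)).2
    ⟨by omega, fun a ha => Multiset.of_mem_filter ha⟩
  refine ⟨σ, ?_, ?_⟩
  · rw [mem_alternatingGroup, sign_of_cycleType, hσ, Even.neg_one_pow]
    rw [← hl, Multiset.card_add, Multiset.card_replicate, ← hmsum] at heven
    grind
  · rw [parts_partition, ← sum_cycleType, hσ, ← hmsum, Nat.add_sub_cancel_left, hl]

theorem exists_cycle_factor {σ : Equiv.Perm α} {q : ℕ} {s : Multiset ℕ} (hq : 2 ≤ q)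
    (hσ : σ.partition.parts = q ::ₘ s) :
    ∃ c τ : Equiv.Perm α, τ.Disjoint c ∧ σ = τ * c ∧ c.IsCycle ∧ c.support.card = q ∧
      τ.cycleType = s.filter (2 ≤ ·) := by
  have htype : q ::ₘ s.filter (2 ≤ ·) = σ.cycleType := by
    rw [← filter_parts_partition_eq_cycleType, hσ, Multiset.filter_cons_of_pos _ hq]
  obtain ⟨c, hc, hcq⟩ : ∃ c ∈ σ.cycleFactorsFinset, c.support.card = q := by
    have hmem : q ∈ σ.cycleType := htype ▸ Multiset.mem_cons_self _ _
    rwa [cycleType_def, Multiset.mem_map] at hmem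
  have hcyc : c.IsCycle := (mem_cycleFactorsFinset_iff.1 hc).1
  refine ⟨c, σ * c⁻¹, disjoint_mul_inv_of_mem_cycleFactorsFinset hc, by group, hcyc, hcq, ?_⟩
  rw [cycleType_mul_inv_mem_cycleFactorsFinset_eq_sub hc, hcyc.cycleType, hcq, ← htype,
    ← Multiset.singleton_add, add_tsub_cancel_left]

theorem exists_isCycle_mem_of_cons_mem_cycleTypes {H : Subgroup (Equiv.Perm α)} {q : ℕ}
    {s : Multiset ℕ} (hq : 2 ≤ q) (hs : ∀ x ∈ s, q.Coprime x) (hH : q ::ₘ s ∈ cycleTypes H) :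
    ∃ c ∈ H, c.IsCycle ∧ c.support.card = q := by
  obtain ⟨σ, hσ, hparts⟩ := hH
  obtain ⟨c, τ, hdis, rfl, hcyc, hcq, hτ⟩ := exists_cycle_factor hq hparts
  have hcop : (orderOf τ).Coprime (orderOf c) := by
    have hprod : q.Coprime (s.filter (2 ≤ ·)).prod := Nat.coprime_multiset_prod_right_iff.2
      fun x hx => hs x (Multiset.mem_of_mem_filter hx)
    rw [hcyc.orderOf, hcq, ← lcm_cycleType, hτ]
    exact (hprod.coprime_dvd_right (Multiset.lcm_dvd.2 fun _ => Multiset.dvd_prod)).symm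
  have hpow : (τ * c) ^ orderOf τ = c ^ orderOf τ := by
    rw [hdis.commute.mul_pow, pow_orderOf_eq_one, one_mul]
  refine ⟨(τ * c) ^ orderOf τ, H.pow_mem hσ _, ?_, ?_⟩
  · rw [hpow]
    exact hcyc.pow_iff.2 hcop
  · rw [hpow, support_pow_coprime hcop, hcq]

theorem cycleType_eq_add_subtypePerm (σ : Equiv.Perm α) {p : α → Prop} [DecidablePred p]
    (hp : ∀ x, p (σ x) ↔ p x) :
    σ.cycleType = (σ.subtypePerm hp).cycleType +
      (σ.subtypePerm (p := fun x => ¬ p x) fun x => not_congr (hp x)).cycleType := by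
  set a := σ.subtypePerm hp
  set b := σ.subtypePerm (p := fun x => ¬ p x) fun x => not_congr (hp x)
  have hdis : (ofSubtype a).Disjoint (ofSubtype b) := fun x => by
    by_cases hx : p x
    · exact .inr (ofSubtype_apply_of_not_mem b (not_not_intro hx))
    · exact .inl (ofSubtype_apply_of_not_mem a hx)
  have hmul : σ = ofSubtype a * ofSubtype b := by
    ext x
    by_cases hx : p x
    · rw [mul_apply, ofSubtype_apply_of_not_mem b (not_not_intro hx), ofSubtype_apply_of_mem a hx]
      rfl
    · rw [hdis.commute.eq, mul_apply, ofSubtype_apply_of_not_mem a hx, ofSubtype_apply_of_mem b hx]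
      rfl
  conv_lhs => rw [hmul]
  rw [hdis.cycleType_mul, cycleType_ofSubtype, cycleType_ofSubtype]

theorem parts_partition_eq_add_subtypePerm (σ : Equiv.Perm α) {p : α → Prop} [DecidablePred p]
    (hp : ∀ x, p (σ x) ↔ p x) :
    σ.partition.parts = (σ.subtypePerm hp).partition.parts +
      (σ.subtypePerm (p := fun x => ¬ p x) fun x => not_congr (hp x)).partition.parts := by
  set a := σ.subtypePerm hp
  set b := σ.subtypePerm (p := fun x => ¬ p x) fun x => not_congr (hp x)
  have htype : σ.cycleType = a.cycleType + b.cycleType := cycleType_eq_add_subtypePerm σ hp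
  have hsupp : σ.support.card = a.support.card + b.support.card := by
    simp only [← sum_cycleType, htype, Multiset.sum_add]
  have hfix : Fintype.card α - σ.support.card = (Fintype.card {x // p x} - a.support.card) +
      (Fintype.card {x // ¬ p x} - b.support.card) := by
    have := a.support.card_le_univ
    have := b.support.card_le_univ
    have := Fintype.card_subtype_compl p
    have := Fintype.card_subtype_le p
    omega
  rw [parts_partition, parts_partition, parts_partition, htype, hfix, Multiset.replicate_add]
  exact add_add_add_comm _ _ _ _

theorem exists_le_parts_sum_eq_card (σ : Equiv.Perm α) {p : α → Prop} [DecidablePred p]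
    (hp : ∀ x, p (σ x) ↔ p x) : ∃ t ≤ σ.partition.parts, t.sum = Fintype.card {x // p x} :=
  ⟨_, (Multiset.le_add_right _ _).trans_eq (parts_partition_eq_add_subtypePerm σ hp).symm,
    (σ.subtypePerm hp).partition.parts_sum⟩

end CycleTypes

section Trichotomy

/-- Every multiset in `S` has a submultiset with sum `k`. The cycle types of a permutation group
that preserves a set of `k` points have this property. -/
def HasPartialSum (S : Set (Multiset ℕ)) (k : ℕ) : Prop :=
  ∀ l ∈ S, ∃ t ≤ l, t.sum = k

/-- The restriction on the cycle types of a transitive permutation group of degree `n` that comes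
from a nontrivial block of size `d`. -/
structure HasBlockSize (n : ℕ) (S : Set (Multiset ℕ)) (d : ℕ) : Prop where
  one_lt : 1 < d
  lt : d < n
  dvd : d ∣ n
  dvd_sub : ∀ {q s}, 2 ≤ q → (∀ x ∈ s, q.Coprime x) → q ::ₘ s ∈ S → d ≤ q → d ∣ n - q

/-- No multiset in `S` is the cycle type of a permutation of degree `n` some power of which is a
cycle of prime length with at least three fixed points. -/
def AvoidsPrimeCycle (n : ℕ) (S : Set (Multiset ℕ)) : Prop :=
  ∀ q s, q.Prime → q + 3 ≤ n → (∀ x ∈ s, q.Coprime x) → q ::ₘ s ∉ S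

/-- The alternative between the restrictions that an intransitive, imprimitive or primitive
permutation group of degree `n` without the alternating group imposes on its cycle types. -/
def TypeTrichotomy (n : ℕ) (S : Set (Multiset ℕ)) : Prop :=
  (∃ k, 0 < k ∧ k < n ∧ HasPartialSum S k) ∨ (∃ d, HasBlockSize n S d) ∨ AvoidsPrimeCycle n S

variable {α : Type*} [Fintype α] [DecidableEq α] {H : Subgroup (Equiv.Perm α)}

theorem exists_hasPartialSum_of_not_isPretransitive (hH : ¬ IsPretransitive H α) :
    ∃ k, 0 < k ∧ k < Fintype.card α ∧ HasPartialSum (cycleTypes H) k := by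
  classical
  rw [isPretransitive_iff] at hH
  push Not at hH
  obtain ⟨x, y, hxy⟩ := hH
  refine ⟨Fintype.card {z // z ∈ orbit H x}, Fintype.card_pos_iff.2 ⟨x, mem_orbit_self x⟩,
    Fintype.card_subtype_lt (x := y) fun ⟨g, hg⟩ => hxy g hg, ?_⟩
  rintro l ⟨σ, hσ, rfl⟩
  refine exists_le_parts_sum_eq_card σ fun z => ?_
  change (⟨σ, hσ⟩ : H) • z ∈ orbit H x ↔ _
  rw [← orbit_eq_iff, orbit_smul, orbit_eq_iff]

theorem exists_hasBlockSize_of_not_isPreprimitive [IsPretransitive H α]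
    (hH : ¬ IsPreprimitive H α) : ∃ d, HasBlockSize (Fintype.card α) (cycleTypes H) d := by
  obtain ⟨B, hB, hBtriv⟩ : ∃ B : Set α, IsBlock H B ∧ ¬ IsTrivialBlock B := by
    by_contra! h
    exact hH ⟨fun {B} hB => h B hB⟩
  rw [IsTrivialBlock, not_or, Set.not_subsingleton_iff] at hBtriv
  obtain ⟨hnontriv, hne_univ⟩ := hBtriv
  refine ⟨B.ncard, Set.one_lt_ncard_iff_nontrivial.2 hnontriv, ?_, ?_, ?_⟩
  · rw [← Nat.card_eq_fintype_card, ← Set.ncard_univ]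
    exact Set.ncard_lt_ncard (Set.ssubset_univ_iff.2 hne_univ)
  · rw [← Nat.card_eq_fintype_card]
    exact hB.ncard_dvd_card hnontriv.nonempty
  · intro q s hq hs hmem hle
    obtain ⟨c, hcH, hc, rfl⟩ := exists_isCycle_mem_of_cons_mem_cycleTypes hq hs hmem
    rw [← Finset.card_compl]
    exact ncard_dvd_card_compl_support_of_isBlock hB hnontriv.nonempty hcH hc hle

theorem avoidsPrimeCycle_of_isPreprimitive (hprim : IsPreprimitive H α)
    (hH : ¬ alternatingGroup α ≤ H) : AvoidsPrimeCycle (Fintype.card α) (cycleTypes H) := by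
  intro q s hq hcard hs hmem
  obtain ⟨c, hcH, hc, rfl⟩ := exists_isCycle_mem_of_cons_mem_cycleTypes hq.two_le hs hmem
  exact hH (alternatingGroup_le_of_isPreprimitive_of_prime_cycle_mem hprim hc hq hcard hcH)

theorem typeTrichotomy_cycleTypes (hH : ¬ alternatingGroup α ≤ H) :
    TypeTrichotomy (Fintype.card α) (cycleTypes H) := by
  by_cases htr : IsPretransitive H α
  · by_cases hprim : IsPreprimitive H α
    · exact .inr (.inr (avoidsPrimeCycle_of_isPreprimitive hprim hH))
    · exact .inr (.inl (exists_hasBlockSize_of_not_isPreprimitive hprim))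
  · exact .inl (exists_hasPartialSum_of_not_isPretransitive htr)

end Trichotomy

section CoversEvenTypes

/-- Every cycle type of an even permutation of degree `n` belongs to `S` or to `T`. A permutation
of degree `n` with `m` cycles, fixed points included, is even if and only if `n + m` is even. -/
def CoversEvenTypes (n : ℕ) (S T : Set (Multiset ℕ)) : Prop :=
  ∀ l : Multiset ℕ, (∀ x ∈ l, 0 < x) → l.sum = n → Even (n + l.card) → l ∈ S ∨ l ∈ T

variable {n : ℕ} {S T : Set (Multiset ℕ)}

theorem CoversEvenTypes.symm (h : CoversEvenTypes n S T) : CoversEvenTypes n T S :=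
  fun l hpos hsum heven => (h l hpos hsum heven).symm

theorem CoversEvenTypes.single (h : CoversEvenTypes n S T) (hn : n % 2 = 1) :
    {n} ∈ S ∨ {n} ∈ T :=
  h _ (by simp only [Multiset.mem_singleton]; omega) (by simp)
    (by simp only [Multiset.card_singleton, Nat.even_iff]; omega)

theorem CoversEvenTypes.pair (h : CoversEvenTypes n S T) (hn : n % 2 = 0) (a b : ℕ)
    (ha : 0 < a := by omega) (hb : 0 < b := by omega) (hs : a + b = n := by omega) :
    {a, b} ∈ S ∨ {a, b} ∈ T :=
  h _ (by simp [ha, hb]) (by simp [hs]) (by simp [Nat.even_iff]; omega)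

theorem CoversEvenTypes.triple (h : CoversEvenTypes n S T) (hn : n % 2 = 1) (a b c : ℕ)
    (ha : 0 < a := by omega) (hb : 0 < b := by omega) (hc : 0 < c := by omega)
    (hs : a + b + c = n := by omega) : {a, b, c} ∈ S ∨ {a, b, c} ∈ T :=
  h _ (by simp [ha, hb, hc]) (by simp; omega) (by simp [Nat.even_iff]; omega)

theorem CoversEvenTypes.quadruple (h : CoversEvenTypes n S T) (hn : n % 2 = 0) (a b c d : ℕ)
    (ha : 0 < a := by omega) (hb : 0 < b := by omega) (hc : 0 < c := by omega)
    (hd : 0 < d := by omega) (hs : a + b + c + d = n := by omega) :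
    {a, b, c, d} ∈ S ∨ {a, b, c, d} ∈ T :=
  h _ (by simp [ha, hb, hc, hd]) (by simp; omega) (by simp [Nat.even_iff]; omega)

theorem AvoidsPrimeCycle.pair (h : AvoidsPrimeCycle n S) (hcov : CoversEvenTypes n S T)
    (hn : n % 2 = 0) (r b : ℕ) (hr : r.Prime := by norm_num) (hb : 3 ≤ b := by omega)
    (hs : r + b = n := by omega) (hrb : ¬ r ∣ b := by omega) : {r, b} ∈ T := by
  refine (hcov.pair hn r b hr.pos).resolve_left (h r _ hr (by omega) ?_)
  simpa using hr.coprime_iff_not_dvd.2 hrb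

theorem AvoidsPrimeCycle.triple (h : AvoidsPrimeCycle n S) (hcov : CoversEvenTypes n S T)
    (hn : n % 2 = 1) (r b c : ℕ) (hr : r.Prime := by norm_num) (hb : 0 < b := by omega)
    (hc : 0 < c := by omega) (hbc : 3 ≤ b + c := by omega) (hs : r + b + c = n := by omega)
    (hrb : ¬ r ∣ b := by omega) (hrc : ¬ r ∣ c := by omega) : {r, b, c} ∈ T := by
  refine (hcov.triple hn r b c hr.pos).resolve_left (h r _ hr (by omega) ?_)
  simpa using And.intro (hr.coprime_iff_not_dvd.2 hrb) (hr.coprime_iff_not_dvd.2 hrc)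

theorem AvoidsPrimeCycle.quadruple (h : AvoidsPrimeCycle n S) (hcov : CoversEvenTypes n S T)
    (hn : n % 2 = 0) (r b c d : ℕ) (hr : r.Prime := by norm_num) (hb : 0 < b := by omega)
    (hc : 0 < c := by omega) (hd : 0 < d := by omega) (hs : r + b + c + d = n := by omega)
    (hrb : ¬ r ∣ b := by omega) (hrc : ¬ r ∣ c := by omega) (hrd : ¬ r ∣ d := by omega) :
    {r, b, c, d} ∈ T := by
  refine (hcov.quadruple hn r b c d hr.pos).resolve_left (h r _ hr (by omega) ?_)
  simpa using And.intro (hr.coprime_iff_not_dvd.2 hrb)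
    (And.intro (hr.coprime_iff_not_dvd.2 hrc) (hr.coprime_iff_not_dvd.2 hrd))

end CoversEvenTypes

section PartialSums

theorem exists_le_cons_sum_eq {a k : ℕ} {s : Multiset ℕ} (h : ∃ t ≤ a ::ₘ s, t.sum = k) :
    (∃ t ≤ s, t.sum = k) ∨ ∃ j, k = a + j ∧ ∃ t ≤ s, t.sum = j := by
  obtain ⟨t, ht, rfl⟩ := h
  rw [← Multiset.mem_powerset, Multiset.powerset_cons, Multiset.mem_add, Multiset.mem_map] at ht
  rcases ht with ht | ⟨t', ht', rfl⟩
  · exact .inl ⟨t, Multiset.mem_powerset.1 ht, rfl⟩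
  · exact .inr ⟨t'.sum, Multiset.sum_cons _ _, t', Multiset.mem_powerset.1 ht', rfl⟩

theorem eq_of_exists_le_singleton {a k : ℕ} (h : ∃ t ≤ ({a} : Multiset ℕ), t.sum = k) :
    k = 0 ∨ k = a := by
  obtain ⟨t, ht, rfl⟩ := h
  rcases Multiset.le_singleton.1 ht with rfl | rfl <;> simp

theorem eq_of_exists_le_pair {a b k : ℕ} (h : ∃ t ≤ ({a, b} : Multiset ℕ), t.sum = k) :
    k = 0 ∨ k = b ∨ k = a ∨ k = a + b := by
  rcases exists_le_cons_sum_eq h with h | ⟨j, hj, h⟩ <;>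
    have := eq_of_exists_le_singleton h <;> omega

theorem eq_of_exists_le_triple {a b c k : ℕ} (h : ∃ t ≤ ({a, b, c} : Multiset ℕ), t.sum = k) :
    k = 0 ∨ k = c ∨ k = b ∨ k = b + c ∨ k = a ∨ k = a + c ∨ k = a + b ∨ k = a + b + c := by
  rcases exists_le_cons_sum_eq h with h | ⟨j, hj, h⟩ <;>
    have := eq_of_exists_le_pair h <;> omega

theorem eq_of_exists_le_quadruple {a b c d k : ℕ}
    (h : ∃ t ≤ ({a, b, c, d} : Multiset ℕ), t.sum = k) :
    (k = 0 ∨ k = d ∨ k = c ∨ k = c + d ∨ k = b ∨ k = b + d ∨ k = b + c ∨ k = b + c + d) ∨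
    (k = a ∨ k = a + d ∨ k = a + c ∨ k = a + c + d ∨ k = a + b ∨ k = a + b + d ∨ k = a + b + c ∨
      k = a + b + c + d) := by
  rcases exists_le_cons_sum_eq h with h | ⟨j, hj, h⟩ <;>
    have := eq_of_exists_le_triple h <;> omega

end PartialSums

section BlockSizes

variable {n d : ℕ} {S : Set (Multiset ℕ)}

theorem HasBlockSize.two_mul_le (h : HasBlockSize n S d) : 2 * d ≤ n :=
  Nat.mul_comm d 2 ▸ Nat.mul_two d ▸ Nat.add_le_of_le_sub h.lt.le
    (Nat.le_of_dvd (Nat.sub_pos_of_lt h.lt) (Nat.dvd_sub h.dvd dvd_rfl))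

theorem HasBlockSize.three_mul_le (h : HasBlockSize n S d) (hn : n % 2 = 1) : 3 * d ≤ n := by
  obtain ⟨e, rfl⟩ := h.dvd
  have h1 : 1 < e := (lt_mul_iff_one_lt_right (one_pos.trans h.one_lt)).1 h.lt
  have h2 : e ≠ 2 := by rintro rfl; omega
  rw [Nat.mul_comm d]
  exact Nat.mul_le_mul_right d (by omega)

/-- A `q`-cycle with `d ≤ q` forces `d ∣ n - q`, hence `d ∣ q`. -/
theorem HasBlockSize.cons_notMem (h : HasBlockSize n S d) {q : ℕ} {s : Multiset ℕ}
    (hn : q + s.sum = n) (hd : d ≤ q) (hq : ∀ x ∈ s, q.Coprime x) (hsum : q.Coprime s.sum) :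
    q ::ₘ s ∉ S := by
  intro hmem
  have hds : d ∣ s.sum := by
    simpa [← hn] using h.dvd_sub (h.one_lt.trans_le hd) hq hmem hd
  have hdq : d ∣ q := (Nat.dvd_add_left hds).1 (hn ▸ h.dvd)
  exact h.one_lt.ne' (Nat.eq_one_of_dvd_coprimes hsum hdq hds)

theorem HasBlockSize.pair_notMem (h : HasBlockSize n S d) (a q : ℕ) (hq : q.Coprime a)
    (hn : a + q = n := by omega) (hd : d ≤ q := by omega) : {a, q} ∉ S := by
  rw [Multiset.pair_comm]
  exact h.cons_notMem (by simpa [add_comm] using hn) hd (by simpa using hq) (by simpa using hq)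

theorem HasBlockSize.triple_notMem (h : HasBlockSize n S d) (a b q : ℕ) (ha : q.Coprime a)
    (hb : q.Coprime b) (hab : q.Coprime (a + b)) (hn : a + b + q = n := by omega)
    (hd : d ≤ q := by omega) : {a, b, q} ∉ S := by
  have hrot : ({a, b, q} : Multiset ℕ) = q ::ₘ {a, b} := by
    simp only [← Multiset.singleton_add, Multiset.insert_eq_cons]
    abel
  rw [hrot]
  exact h.cons_notMem (by simp; omega) hd (by simpa using ⟨ha, hb⟩) (by simpa using hab)

end BlockSizes

section OddDegree

variable {n k d : ℕ} {S T : Set (Multiset ℕ)}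

theorem coprime_of_prime_of_not_dvd {a r : ℕ} (hr : r.Prime := by norm_num)
    (ha : ¬ r ∣ a := by omega) : a.Coprime r :=
  (hr.coprime_iff_not_dvd.2 ha).symm

theorem coprime_two_pow {a : ℕ} (m : ℕ) (ha : ¬ 2 ∣ a := by omega) : a.Coprime (2 ^ m) :=
  (coprime_of_prime_of_not_dvd).pow_right m

theorem AvoidsPrimeCycle.not_hasBlockSize_of_odd (hS : AvoidsPrimeCycle n S)
    (hcov : CoversEvenTypes n S T) (hn : n % 2 = 1) (h9 : 9 ≤ n) : ¬ HasBlockSize n T d := by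
  intro hT
  have h3d := hT.three_mul_le hn
  by_cases h3 : n % 3 = 1
  · by_cases h5 : n % 5 = 1
    · exact hT.triple_notMem 5 3 (n - 8) coprime_of_prime_of_not_dvd coprime_of_prime_of_not_dvd
        (coprime_two_pow 3) (by omega) (by omega) (hS.triple hcov hn 5 3 (n - 8))
    · have h6 : (n - 6).Coprime (2 * 3) :=
        (coprime_of_prime_of_not_dvd).mul_right (coprime_of_prime_of_not_dvd)
      exact hT.triple_notMem 5 1 (n - 6) coprime_of_prime_of_not_dvd (Nat.coprime_one_right _) h6
        (by omega) (by omega) (hS.triple hcov hn 5 1 (n - 6))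
  · exact hT.triple_notMem 3 1 (n - 4) coprime_of_prime_of_not_dvd (Nat.coprime_one_right _)
      (coprime_two_pow 2) (by omega) (by omega) (hS.triple hcov hn 3 1 (n - 4))

theorem AvoidsPrimeCycle.eq_nine_of_hasPartialSum (hS : AvoidsPrimeCycle n S)
    (hcov : CoversEvenTypes n S T) (hn : n % 2 = 1) (h9 : 9 ≤ n) (hk0 : 0 < k) (hkn : k < n)
    (hk : HasPartialSum T k) : n = 9 ∧ (k = 4 ∨ k = 5) := by
  obtain h3 | h3 | h3 : n % 3 = 0 ∨ n % 3 = 1 ∨ n % 3 = 2 := by omega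
  · have h₁ := eq_of_exists_le_triple (hk _ (hS.triple hcov hn 3 1 (n - 4)))
    have h₂ := eq_of_exists_le_triple (hk _ (hS.triple hcov hn 3 2 (n - 5)))
    by_cases h5 : n % 5 = 2
    · have h₃ := eq_of_exists_le_triple (hk _ (hS.triple hcov hn 5 1 (n - 6)))
      omega
    · have h₃ := eq_of_exists_le_triple (hk _ (hS.triple hcov hn 5 2 (n - 7)))
      omega
  · have h₁ := eq_of_exists_le_triple (hk _ (hS.triple hcov hn 3 2 (n - 5)))
    have h₂ := eq_of_exists_le_triple (hk _ (hS.triple hcov hn 3 5 (n - 8)))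
    by_cases h7 : n % 7 = 2
    · have h₃ := eq_of_exists_le_triple (hk _ (hS.triple hcov hn 7 1 (n - 8)))
      omega
    · have h₃ := eq_of_exists_le_triple (hk _ (hS.triple hcov hn 7 2 (n - 9)))
      omega
  · have h₁ := eq_of_exists_le_triple (hk _ (hS.triple hcov hn 3 1 (n - 4)))
    have h₂ := eq_of_exists_le_triple (hk _ (hS.triple hcov hn 3 4 (n - 7)))
    by_cases h11 : n = 11
    · have h₃ := eq_of_exists_le_triple (hk _ (hS.triple hcov hn 5 2 (n - 7)))
      have h₄ := eq_of_exists_le_triple (hk _ (hS.triple hcov hn 5 3 (n - 8)))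
      omega
    by_cases h5 : n % 5 = 2
    · have h₃ := eq_of_exists_le_triple (hk _ (hS.triple hcov hn 5 1 (n - 6)))
      omega
    · have h₃ := eq_of_exists_le_triple (hk _ (hS.triple hcov hn 5 2 (n - 7)))
      omega

theorem AvoidsPrimeCycle.not_avoidsPrimeCycle_of_odd (hS : AvoidsPrimeCycle n S)
    (hcov : CoversEvenTypes n S T) (hn : n % 2 = 1) (h9 : 9 ≤ n) : ¬ AvoidsPrimeCycle n T := by
  intro hT
  by_cases h3 : n % 3 = 1
  · refine hT 3 _ (by norm_num) (by omega) ?_ (hS.triple hcov hn 3 2 (n - 5))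
    have : Nat.Coprime 3 (n - 5) := Nat.prime_three.coprime_iff_not_dvd.2 (by omega)
    simpa using And.intro (by decide : Odd 3) this
  · refine hT 3 _ (by norm_num) (by omega) ?_ (hS.triple hcov hn 3 1 (n - 4))
    have : Nat.Coprime 3 (n - 4) := Nat.prime_three.coprime_iff_not_dvd.2 (by omega)
    simpa using this

theorem AvoidsPrimeCycle.eq_nine_of_odd (hS : AvoidsPrimeCycle n S) (hT : TypeTrichotomy n T)
    (hcov : CoversEvenTypes n S T) (hn : n % 2 = 1) (h9 : 9 ≤ n) :
    n = 9 ∧ ∃ k, (k = 4 ∨ k = 5) ∧ HasPartialSum T k := by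
  rcases hT with ⟨k, hk0, hkn, hk⟩ | ⟨d, hd⟩ | hT
  · have ⟨hn9, hk45⟩ := hS.eq_nine_of_hasPartialSum hcov hn h9 hk0 hkn hk
    exact ⟨hn9, k, hk45, hk⟩
  · exact (hS.not_hasBlockSize_of_odd hcov hn h9 hd).elim
  · exact (hS.not_avoidsPrimeCycle_of_odd hcov hn h9 hT).elim

theorem HasBlockSize.one_one_notMem (h : HasBlockSize n S d) (hn : n % 2 = 1) (h5 : 5 ≤ n) :
    {1, 1, n - 2} ∉ S := by
  have h3d := h.three_mul_le hn
  exact h.triple_notMem 1 1 (n - 2) (Nat.coprime_one_right _)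
    (Nat.coprime_one_right _) (coprime_two_pow 1)

theorem HasBlockSize.not_hasPartialSum_of_odd (hS : HasBlockSize n S d)
    (hcov : CoversEvenTypes n S T) (hn : n % 2 = 1) (h9 : 9 ≤ n) (hk0 : 0 < k) (hkn : k < n) :
    ¬ HasPartialSum T k := by
  intro hk
  have h3d := hS.three_mul_le hn
  have h₁ := eq_of_exists_le_triple <| hk _ <|
    (hcov.triple hn 1 1 (n - 2)).resolve_left (hS.one_one_notMem hn (by omega))
  by_cases hk1 : k = 1 ∨ k = n - 1
  · have h₂ := eq_of_exists_le_triple <| hk _ <| (hcov.triple hn 2 2 (n - 4)).resolve_left <|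
      hS.triple_notMem 2 2 (n - 4) (coprime_two_pow 1) (coprime_two_pow 1) (coprime_two_pow 2)
    omega
  by_cases hn9 : n = 9
  · have h₂ := eq_of_exists_le_triple <| hk _ <| (hcov.triple hn 3 1 5).resolve_left <|
      hS.triple_notMem 3 1 5 (by norm_num) (by norm_num) (by norm_num)
    omega
  · have h₂ := eq_of_exists_le_triple <| hk _ <| (hcov.triple hn 4 4 (n - 8)).resolve_left <|
      hS.triple_notMem 4 4 (n - 8) (coprime_two_pow 2) (coprime_two_pow 2) (coprime_two_pow 3)
    omega

theorem avoidsPrimeCycle_of_odd_of_singleton_mem (hS : TypeTrichotomy n S)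
    (hT : TypeTrichotomy n T) (hcov : CoversEvenTypes n S T) (hn : n % 2 = 1) (h9 : 9 ≤ n)
    (hSn : {n} ∈ S) : AvoidsPrimeCycle n S ∨ AvoidsPrimeCycle n T := by
  rcases hS with ⟨k, hk0, hkn, hk⟩ | ⟨d, hd⟩ | hS
  · have := eq_of_exists_le_singleton (hk _ hSn)
    omega
  · rcases hT with ⟨k, hk0, hkn, hk⟩ | ⟨e, he⟩ | hT
    · exact (hd.not_hasPartialSum_of_odd hcov hn h9 hk0 hkn hk).elim
    · rcases hcov.triple hn 1 1 (n - 2) with h | h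
      · exact (hd.one_one_notMem hn (by omega) h).elim
      · exact (he.one_one_notMem hn (by omega) h).elim
    · exact .inr hT
  · exact .inl hS

theorem odd_degree_exception (hS : TypeTrichotomy n S) (hT : TypeTrichotomy n T)
    (hcov : CoversEvenTypes n S T) (hn : n % 2 = 1) (h9 : 9 ≤ n) :
    n = 9 ∧ ((AvoidsPrimeCycle n S ∧ ∃ k, (k = 4 ∨ k = 5) ∧ HasPartialSum T k) ∨
      (AvoidsPrimeCycle n T ∧ ∃ k, (k = 4 ∨ k = 5) ∧ HasPartialSum S k)) := by
  have : AvoidsPrimeCycle n S ∨ AvoidsPrimeCycle n T := by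
    rcases hcov.single hn with h | h
    · exact avoidsPrimeCycle_of_odd_of_singleton_mem hS hT hcov hn h9 h
    · exact (avoidsPrimeCycle_of_odd_of_singleton_mem hT hS hcov.symm hn h9 h).symm
  rcases this with h | h
  · exact (h.eq_nine_of_odd hT hcov hn h9).imp_right fun hk => .inl ⟨h, hk⟩
  · exact (h.eq_nine_of_odd hS hcov.symm hn h9).imp_right fun hk => .inr ⟨h, hk⟩

end OddDegree

section EvenDegree

variable {n k d r : ℕ} {S T : Set (Multiset ℕ)}

theorem exists_prime_not_dvd_of_even (hn : n % 2 = 0) (h10 : 10 ≤ n) :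
    ∃ r, r.Prime ∧ r + 3 ≤ n ∧ ¬ r ∣ n := by
  by_cases h3 : 3 ∣ n
  · obtain ⟨r, hr, hlt, hle⟩ := Nat.exists_prime_lt_and_le_two_mul (n / 2 - 1) (by omega)
    have hr2 := hr.eq_two_or_odd
    have hr3 : ¬ 3 ∣ r := fun h => by
      have := (Nat.prime_dvd_prime_iff_eq Nat.prime_three hr).1 h
      omega
    refine ⟨r, hr, by omega, fun ⟨e, he⟩ => ?_⟩
    have : e < 3 := by
      by_contra! he3
      have := Nat.mul_le_mul_left r he3
      omega
    interval_cases e <;> omega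
  · exact ⟨3, Nat.prime_three, by omega, h3⟩

theorem coprime_sub_of_prime_of_not_dvd (hr : r.Prime) (hrn : r ≤ n) (hdvd : ¬ r ∣ n) :
    r.Coprime (n - r) :=
  (Nat.coprime_sub_self_right hrn).2 (hr.coprime_iff_not_dvd.2 hdvd)

theorem HasBlockSize.prime_pair_notMem (h : HasBlockSize n T d) (hr : r.Prime) (hrn : r ≤ n)
    (hdvd : ¬ r ∣ n) : {r, n - r} ∉ T := by
  have h2d := h.two_mul_le
  have hcop := coprime_sub_of_prime_of_not_dvd hr hrn hdvd
  by_cases hd : d ≤ r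
  · rw [Multiset.pair_comm]
    exact h.pair_notMem _ _ hcop
  · exact h.pair_notMem _ _ hcop.symm

theorem AvoidsPrimeCycle.prime_pair_notMem (h : AvoidsPrimeCycle n T) (hr : r.Prime)
    (hrn : r + 3 ≤ n) (hdvd : ¬ r ∣ n) : {r, n - r} ∉ T :=
  h r _ hr hrn (by simpa using coprime_sub_of_prime_of_not_dvd hr (by omega) hdvd)

theorem exists_hasPartialSum_of_prime_pair_mem (hT : TypeTrichotomy n T) (hn : n % 2 = 0)
    (h10 : 10 ≤ n) (hpair : ∀ r, r.Prime → r + 3 ≤ n → ¬ r ∣ n → {r, n - r} ∈ T) :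
    ∃ k, 0 < k ∧ k < n ∧ HasPartialSum T k := by
  obtain ⟨r, hr, hrn, hdvd⟩ := exists_prime_not_dvd_of_even hn h10
  have hmem := hpair r hr hrn hdvd
  rcases hT with hk | ⟨d, hd⟩ | hT
  · exact hk
  · exact (hd.prime_pair_notMem hr (by omega) hdvd hmem).elim
  · exact (hT.prime_pair_notMem hr hrn hdvd hmem).elim

theorem pair_mem_of_hasPartialSum (hk : HasPartialSum S k) (hk0 : 0 < k) (hkn : k < n)
    (hS1 : {1, n - 1} ∈ S) (hcov : CoversEvenTypes n S T) (hn : n % 2 = 0) {a b : ℕ}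
    (ha : 2 ≤ a) (hb : 2 ≤ b) (hab : a + b = n) : {a, b} ∈ T := by
  refine (hcov.pair hn a b).resolve_left fun h => ?_
  have h1 := eq_of_exists_le_pair (hk _ hS1)
  have h2 := eq_of_exists_le_pair (hk _ h)
  omega

theorem avoidsPrimeCycle_of_even_of_pair_mem (hS : TypeTrichotomy n S) (hT : TypeTrichotomy n T)
    (hcov : CoversEvenTypes n S T) (hn : n % 2 = 0) (h10 : 10 ≤ n) (hS1 : {1, n - 1} ∈ S) :
    AvoidsPrimeCycle n S := by
  rcases hS with ⟨k, hk0, hkn, hk⟩ | ⟨d, hd⟩ | hS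
  · have hmem : ∀ a b, 2 ≤ a → 2 ≤ b → a + b = n → {a, b} ∈ T := fun a b ha hb hab =>
      pair_mem_of_hasPartialSum hk hk0 hkn hS1 hcov hn ha hb hab
    obtain ⟨j, hj0, hjn, hj⟩ := exists_hasPartialSum_of_prime_pair_mem hT hn h10
      fun r hr hrn _ => hmem r _ hr.two_le (by omega) (by omega)
    have h2 := eq_of_exists_le_pair (hj _ (hmem 2 (n - 2) (by omega) (by omega) (by omega)))
    have h3 := eq_of_exists_le_pair (hj _ (hmem 3 (n - 3) (by omega) (by omega) (by omega)))
    omega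
  · have hdn := hd.lt
    exact (hd.pair_notMem 1 (n - 1) (Nat.coprime_one_right _) (by omega) (by omega) hS1).elim
  · exact hS

theorem AvoidsPrimeCycle.eq_twelve_of_hasPartialSum (hS : AvoidsPrimeCycle n S)
    (hcov : CoversEvenTypes n S T) (hn : n % 2 = 0) (h10 : 10 ≤ n) (h3 : n % 3 = 0) (hk0 : 0 < k)
    (hkn : k < n) (hk : HasPartialSum T k) : n = 12 ∧ (k = 5 ∨ k = 7) := by
  have h₁ := eq_of_exists_le_quadruple (hk _ (hS.quadruple hcov hn 3 1 1 (n - 5)))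
  have h₂ := eq_of_exists_le_quadruple (hk _ (hS.quadruple hcov hn 3 2 2 (n - 7)))
  by_cases hn12 : n = 12
  · have h₃ := eq_of_exists_le_pair (hk _ (hS.pair hcov hn 5 (n - 5)))
    omega
  · have h₃ := eq_of_exists_le_quadruple (hk _ (hS.quadruple hcov hn 3 4 4 (n - 11)))
    by_cases h5 : n % 5 = 0
    · have h₄ := eq_of_exists_le_quadruple (hk _ (hS.quadruple hcov hn 5 1 1 (n - 7)))
      omega
    · have h₄ := eq_of_exists_le_pair (hk _ (hS.pair hcov hn 5 (n - 5)))
      omega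

theorem AvoidsPrimeCycle.eq_ten_of_hasPartialSum (hS : AvoidsPrimeCycle n S)
    (hcov : CoversEvenTypes n S T) (hn : n % 2 = 0) (h10 : 10 ≤ n) (h3 : n % 3 ≠ 0) (hk0 : 0 < k)
    (hkn : k < n) (hk : HasPartialSum T k) : n = 10 ∧ (k = 3 ∨ k = 7) := by
  have h₁ := eq_of_exists_le_pair (hk _ (hS.pair hcov hn 3 (n - 3)))
  by_cases h5 : n % 5 = 0
  · have h₂ := eq_of_exists_le_quadruple (hk _ (hS.quadruple hcov hn 5 1 1 (n - 7)))
    omega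
  · have h₂ := eq_of_exists_le_pair (hk _ (hS.pair hcov hn 5 (n - 5)))
    omega

theorem even_degree_exception (hS : TypeTrichotomy n S) (hT : TypeTrichotomy n T)
    (hcov : CoversEvenTypes n S T) (hn : n % 2 = 0) (h10 : 10 ≤ n) (hS1 : {1, n - 1} ∈ S) :
    AvoidsPrimeCycle n S ∧ ∃ k, HasPartialSum T k ∧
      ((n = 10 ∧ (k = 3 ∨ k = 7)) ∨ (n = 12 ∧ (k = 5 ∨ k = 7))) := by
  have hS := avoidsPrimeCycle_of_even_of_pair_mem hS hT hcov hn h10 hS1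
  obtain ⟨k, hk0, hkn, hk⟩ := exists_hasPartialSum_of_prime_pair_mem hT hn h10
    fun r hr hrn hdvd => hS.pair hcov hn r (n - r) hr (by omega) (by omega)
      fun h => hdvd ((Nat.dvd_sub_self_right.1 h).resolve_right (by omega))
  refine ⟨hS, k, hk, ?_⟩
  by_cases h3 : n % 3 = 0
  · exact .inr (hS.eq_twelve_of_hasPartialSum hcov hn h10 h3 hk0 hkn hk)
  · exact .inl (hS.eq_ten_of_hasPartialSum hcov hn h10 h3 hk0 hkn hk)

end EvenDegree

theorem exists_conj_apply_ne {α : Type*} {K : Subgroup (Equiv.Perm α)}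
    (hK : IsPretransitive K α) {g : Equiv.Perm α} (hg : g ≠ 1) (a : α) :
    ∃ k ∈ K, (k * g * k⁻¹) a ≠ a := by
  obtain ⟨b, hb⟩ : ∃ b, g b ≠ b := by
    by_contra! h
    exact hg (Equiv.ext h)
  obtain ⟨⟨k, hkK⟩, rfl⟩ := hK.exists_smul_eq b a
  refine ⟨k, hkK, fun h => hb (k.injective ?_)⟩
  simpa using h

section SmallSupport

variable {α : Type*} [Fintype α] [DecidableEq α] {K : Subgroup (Equiv.Perm α)}

/-- On the support of `h` the permutation `g` agrees with the transposition `s` of `a` and `g a`,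
so that `⁅g, h⁆ = s * (h * s * h⁻¹)`. -/
theorem isThreeCycle_commutatorElement {g h : Equiv.Perm α} {a : α} (hga : g a ≠ a)
    (hha : h a ≠ a) (hgh : ∀ x ≠ a, g x = x ∨ h x = x) : IsThreeCycle ⁅g, h⁆ := by
  set s := Equiv.swap (g a) a with hs
  have hhga : h (g a) = g a := (hgh _ hga).resolve_left fun h' => hga (g.injective h')
  have hgha : g a ≠ h a := fun h' => hha (h.injective (h' ▸ hhga))
  have hdisj : Disjoint (s * g) h := by
    intro x
    rw [mul_apply]
    by_cases hxa : x = a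
    · exact .inl (by rw [hxa, hs, Equiv.swap_apply_left])
    by_cases hhx : h x = x
    · exact .inr hhx
    · have hxga : x ≠ g a := fun h' => hhx (h' ▸ hhga)
      exact .inl (by rw [(hgh x hxa).resolve_right hhx, hs,
        Equiv.swap_apply_of_ne_of_ne hxga hxa])
  have hconj : g * h * g⁻¹ = s * h * s := by
    have hcomm := hdisj.commute.eq
    rw [mul_inv_eq_iff_eq_mul, mul_assoc s, mul_assoc, mul_assoc, ← hcomm, mul_assoc,
      ← mul_assoc s s, hs, Equiv.swap_mul_self, one_mul]
  have hcomm : ⁅g, h⁆ = s * Equiv.swap (g a) (h a) := by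
    rw [commutatorElement_def, hconj, mul_assoc, mul_assoc, ← mul_assoc h, hs,
      ← Equiv.swap_apply_apply, hhga]
  rw [hcomm]
  exact isThreeCycle_swap_mul_swap_same hga hgha hha.symm

theorem exists_pow_forall_notMem {c : Equiv.Perm α} (hc : c.IsCycle) {S : Finset α}
    (hS : S ⊆ c.support) (hcard : S.offDiag.card + 1 < c.support.card) :
    ∃ t : ℕ, ∀ s ∈ S, (c ^ t) s ∉ S := by
  by_contra! h
  choose f hf hf' using h
  have hmaps : Set.MapsTo (fun t => (f t, (c ^ t) (f t))) (Finset.Ioo 0 c.support.card)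
      S.offDiag := by
    intro t ht
    rw [Finset.mem_coe, Finset.mem_Ioo] at ht
    rw [Finset.mem_coe, Finset.mem_offDiag]
    refine ⟨hf t, hf' t, fun h => ?_⟩
    have := (hc.pow_eq_one_iff' (n := t) (mem_support.1 (hS (hf t)))).2 h.symm
    rw [← orderOf_dvd_iff_pow_eq_one, hc.orderOf] at this
    exact ht.2.not_ge (Nat.le_of_dvd ht.1 this)
  obtain ⟨t, ht, t', ht', hne, heq⟩ := Finset.exists_ne_map_eq_of_card_lt_of_maps_to
    (by rw [Nat.card_Ioo]; omega) hmaps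
  obtain ⟨hft, hct⟩ := Prod.mk.inj heq
  have hpow : c ^ t = c ^ t' :=
    hc.pow_eq_pow_iff.2 ⟨f t, mem_support.1 (hS (hf t)), by rw [hct, hft]⟩
  rw [pow_inj_mod, hc.orderOf, Nat.mod_eq_of_lt (Finset.mem_Ioo.1 ht).2,
    Nat.mod_eq_of_lt (Finset.mem_Ioo.1 ht').2] at hpow
  exact hne hpow

theorem exists_isCycle_pow_mem_of_cons_mem_cycleTypes {q : ℕ} {s : Multiset ℕ} (hq : 2 ≤ q)
    (hK : q ::ₘ s ∈ cycleTypes K) (m : ℕ) (hm : ∀ x ∈ s, x ∣ m) :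
    ∃ c : Equiv.Perm α, c.IsCycle ∧ c.support.card = q ∧ c ^ m ∈ K := by
  obtain ⟨σ, hσK, hσ⟩ := hK
  obtain ⟨c, τ, hdis, rfl, hc, hcq, hτ⟩ := exists_cycle_factor hq hσ
  have hτm : τ ^ m = 1 := by
    rw [← orderOf_dvd_iff_pow_eq_one, ← lcm_cycleType, hτ, Multiset.lcm_dvd]
    exact fun x hx => hm x (Multiset.mem_of_mem_filter hx)
  have := K.pow_mem hσK m
  rw [hdis.commute.mul_pow, hτm, one_mul] at this
  exact ⟨c, hc, hcq, this⟩

theorem exists_isThreeCycle_mem_of_isCycle (hK : IsPretransitive K α) {c g : Equiv.Perm α}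
    (hcK : c ∈ K) (hc : c.IsCycle) (hcard : c.support.card + 1 = Fintype.card α) (hgK : g ∈ K)
    (hg1 : g ≠ 1) (hg : (g.support.card - 1) * (g.support.card - 2) + 1 < c.support.card) :
    ∃ k ∈ K, IsThreeCycle k := by
  obtain ⟨a, ha⟩ : ∃ a, c.supportᶜ = {a} := Finset.card_eq_one.1 (by rw [Finset.card_compl]; omega)
  have hca : c a = a := by simpa using Finset.ext_iff.1 ha a
  obtain ⟨k, hkK, hka⟩ := exists_conj_apply_ne hK hg1 a
  set g₁ := k * g * k⁻¹ with hg₁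
  have hg₁K : g₁ ∈ K := K.mul_mem (K.mul_mem hkK hgK) (K.inv_mem hkK)
  obtain ⟨t, ht⟩ := exists_pow_forall_notMem hc (S := g₁.support.erase a)
    (by rw [← compl_compl c.support, ha, Finset.compl_singleton]
        exact Finset.erase_subset_erase _ (Finset.subset_univ _))
    (by rwa [Finset.offDiag_card, Finset.card_erase_of_mem (mem_support.2 hka), hg₁,
          card_support_conj, ← Nat.mul_sub_one, Nat.sub_sub])
  have hctK := K.pow_mem hcK t
  set d := c ^ t
  have hda : d a = a := pow_apply_eq_self_of_apply_eq_self hca t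
  have hda' : d⁻¹ a = a := inv_eq_iff_eq.2 hda.symm
  have hhK : d * g₁ * d⁻¹ ∈ K := K.mul_mem (K.mul_mem hctK hg₁K) (K.inv_mem hctK)
  refine ⟨⁅g₁, d * g₁ * d⁻¹⁆, K.mul_mem (K.mul_mem (K.mul_mem hg₁K hhK) (K.inv_mem hg₁K))
    (K.inv_mem hhK), isThreeCycle_commutatorElement hka ?_ fun x hxa => ?_⟩
  · rw [mul_apply, mul_apply, hda']
    exact fun h => hka (d.injective (h.trans hda.symm))
  · by_contra! hx
    have hdx : d (d⁻¹ x) = x := d.apply_symm_apply x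
    have hmem : d⁻¹ x ∈ g₁.support.erase a := by
      refine Finset.mem_erase.2 ⟨fun h => hxa ?_, mem_support.2 fun h => hx.2 ?_⟩
      · rw [inv_eq_iff_eq.1 h, hda]
      · rw [mul_apply, mul_apply, h, hdx]
    exact ht _ hmem (by rw [hdx]; exact Finset.mem_erase.2 ⟨hxa, mem_support.2 hx.1⟩)

theorem AvoidsPrimeCycle.notMem_of_isCycle
    (hK : AvoidsPrimeCycle (Fintype.card α) (cycleTypes K)) {c : Equiv.Perm α} (hc : c.IsCycle)
    (hp : c.support.card.Prime) (hcard : c.support.card + 3 ≤ Fintype.card α) : c ∉ K := by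
  intro hcK
  refine hK _ (Multiset.replicate (Fintype.card α - c.support.card) 1) hp hcard
    (fun x hx => ?_) ⟨c, hcK, ?_⟩
  · rw [Multiset.eq_of_mem_replicate hx]
    exact Nat.coprime_one_right _
  · rw [parts_partition, hc.cycleType, Multiset.singleton_add]

theorem isPretransitive_of_pair_mem {a b c d : ℕ} (hab : {a, b} ∈ cycleTypes K)
    (hcd : {c, d} ∈ cycleTypes K) (hcard : a + b = Fintype.card α) (hbc : b ≠ c) (hbd : b ≠ d) :
    IsPretransitive K α := by
  by_contra h
  obtain ⟨k, hk0, hkn, hk⟩ := exists_hasPartialSum_of_not_isPretransitive h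
  have h1 := eq_of_exists_le_pair (hk _ hab)
  have h2 := eq_of_exists_le_pair (hk _ hcd)
  obtain ⟨σ, -, hσ⟩ := hcd
  have hsum : c + d = Fintype.card α := by simpa [hσ] using σ.partition.parts_sum
  omega

/-- The sixth power of a permutation of type `{4, 6}` has support of size four, so some commutator
of two of its conjugates is a three-cycle. -/
theorem not_avoidsPrimeCycle_of_degree_ten {K : Subgroup (Equiv.Perm (Fin 10))}
    (h9 : {1, 9} ∈ cycleTypes K) (h5 : {5, 5} ∈ cycleTypes K) (h6 : {4, 6} ∈ cycleTypes K) :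
    ¬ AvoidsPrimeCycle 10 (cycleTypes K) := by
  intro hK
  have htr := isPretransitive_of_pair_mem h9 h5 (by simp) (by norm_num) (by norm_num)
  rw [Multiset.pair_comm] at h9
  obtain ⟨c, hcK, hc, hc9⟩ := exists_isCycle_mem_of_cons_mem_cycleTypes (q := 9) (s := {1})
    (by norm_num) (by simp) h9
  obtain ⟨z, hz, hz4, hzK⟩ := exists_isCycle_pow_mem_of_cons_mem_cycleTypes (q := 4) (s := {6})
    (by norm_num) h6 6 (by simp)
  have hzo : orderOf z = 4 := by rw [hz.orderOf, hz4]
  have hsup : (z ^ 6).support.card = 4 := by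
    rw [← pow_mod_orderOf, hzo,
      hz.support_pow_of_pos_of_lt_orderOf (by norm_num) (by rw [hzo]; norm_num), hz4]
  have hne : z ^ 6 ≠ 1 := fun h => by simp [h] at hsup
  obtain ⟨k, hkK, hk3⟩ := exists_isThreeCycle_mem_of_isCycle htr hcK hc (by rw [hc9]; simp) hzK
    hne (by rw [hsup, hc9]; norm_num)
  have hK' : AvoidsPrimeCycle (Fintype.card (Fin 10)) (cycleTypes K) := by
    rwa [Fintype.card_fin]
  exact hK'.notMem_of_isCycle hk3.isCycle (by rw [hk3.card_support]; norm_num)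
    (by rw [hk3.card_support]; simp) hkK

end SmallSupport

section InducedGroup

variable {α : Type*}

/-- The group of permutations of `s` that are induced by those elements of `K` that map `s` to
itself. -/
def inducedGroup (K : Subgroup (Equiv.Perm α)) (s : Finset α) : Subgroup (Equiv.Perm s) where
  carrier := {τ | ∃ k ∈ K, ∀ a : s, k a = τ a}
  one_mem' := ⟨1, K.one_mem, fun _ => rfl⟩
  mul_mem' := by
    rintro τ τ' ⟨k, hk, hτ⟩ ⟨k', hk', hτ'⟩
    exact ⟨k * k', K.mul_mem hk hk', fun a => by rw [mul_apply, hτ', hτ, mul_apply]⟩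
  inv_mem' := by
    rintro τ ⟨k, hk, hτ⟩
    exact ⟨k⁻¹, K.inv_mem hk, fun a => by
      rw [inv_eq_iff_eq, hτ]
      exact congrArg Subtype.val (τ.apply_symm_apply a).symm⟩

theorem subtypePerm_mem_inducedGroup {K : Subgroup (Equiv.Perm α)} {s : Finset α}
    {k : Equiv.Perm α} (hk : k ∈ K) (hs : ∀ a, k a ∈ s ↔ a ∈ s) :
    k.subtypePerm hs ∈ inducedGroup K s :=
  ⟨k, hk, fun _ => rfl⟩

variable [Fintype α] [DecidableEq α] {K : Subgroup (Equiv.Perm α)}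

theorem isPretransitive_inducedGroup_support {c : Equiv.Perm α} (hcK : c ∈ K) (hc : c.IsCycle) :
    IsPretransitive (inducedGroup K c.support) c.support where
  exists_smul_eq a b := by
    obtain ⟨i, hi⟩ := hc.exists_zpow_eq (mem_support.1 a.2) (mem_support.1 b.2)
    exact ⟨⟨_, subtypePerm_mem_inducedGroup (K.zpow_mem hcK i) fun _ => zpow_apply_mem_support⟩,
      Subtype.ext hi⟩

theorem pow_factorial_eq_ofSubtype_pow {s : Finset α} {k : Equiv.Perm α} {c : Equiv.Perm s}
    (hk : ∀ a : s, k a = c a) :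
    k ^ sᶜ.card.factorial = ofSubtype c ^ sᶜ.card.factorial := by
  set d := (ofSubtype c)⁻¹ * k
  have hd : d.support ⊆ sᶜ := fun a ha => Finset.mem_compl.2 fun has => mem_support.1 ha <| by
    rw [mul_apply, inv_eq_iff_eq, hk ⟨a, has⟩, ofSubtype_apply_of_mem c has]
  have hdis : (ofSubtype c).Disjoint d := fun a => by
    by_cases has : a ∈ s
    · exact .inr (notMem_support.1 fun ha => Finset.mem_compl.1 (hd ha) has)
    · exact .inl (ofSubtype_apply_of_not_mem c has)
  have hdpow : d ^ sᶜ.card.factorial = 1 := by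
    rw [← orderOf_dvd_iff_pow_eq_one, ← Nat.card_zpowers]
    refine card_dvd_factorial_of_support_subset ?_
    rintro _ ⟨i, rfl⟩
    exact (support_zpow_le d i).trans hd
  rw [← mul_one (ofSubtype c ^ _), ← hdpow, ← hdis.commute.mul_pow, mul_inv_cancel_left]

theorem exists_isCycle_mem_of_alternatingGroup_le_inducedGroup {s : Finset α}
    (hs : alternatingGroup s ≤ inducedGroup K s) {r : ℕ} (hr : r.Prime) (hodd : Odd r)
    (hrs : r ≤ s.card) (hlt : sᶜ.card < r) : ∃ c ∈ K, c.IsCycle ∧ c.support.card = r := by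
  obtain ⟨c, hcr⟩ := (exists_with_cycleType_iff s (m := {r})).2
    ⟨by simpa using hrs, by simpa using hr.two_le⟩
  obtain ⟨k, hkK, hk⟩ := hs (mem_alternatingGroup.2 (by
    rw [sign_of_cycleType, hcr, Multiset.sum_singleton, Multiset.card_singleton,
      hodd.add_one.neg_one_pow]))
  have hC : (ofSubtype c).IsCycle := by
    rw [← card_cycleType_eq_one, cycleType_ofSubtype, hcr, Multiset.card_singleton]
  have hCcard : (ofSubtype c).support.card = r := by
    rw [← sum_cycleType, cycleType_ofSubtype, hcr, Multiset.sum_singleton]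
  have hcop : sᶜ.card.factorial.Coprime (orderOf (ofSubtype c)) := by
    rw [hC.orderOf, hCcard, Nat.coprime_comm, hr.coprime_iff_not_dvd, hr.dvd_factorial]
    exact hlt.not_ge
  refine ⟨k ^ sᶜ.card.factorial, K.pow_mem hkK _, ?_⟩
  rw [pow_factorial_eq_ofSubtype_pow hk, support_pow_coprime hcop]
  exact ⟨hC.pow_iff.2 hcop, hCcard⟩

end InducedGroup

theorem isPreprimitive_of_card_eq_nine {α : Type*} {K : Subgroup (Equiv.Perm α)}
    (hK : IsPretransitive K α) (hα : Nat.card α = 9) {h : Equiv.Perm α} (hhK : h ∈ K)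
    {q : α} (hq : h q = q) (hh : ∀ y ≠ q, h (h y) ≠ y) :
    IsPreprimitive K α := by
  classical
  have : Finite α := Nat.finite_of_card_ne_zero (by omega)
  refine IsPreprimitive.of_isTrivialBlock_base q fun {B} hqB hB => ?_
  by_contra hnt
  rw [IsTrivialBlock, not_or] at hnt
  obtain ⟨y, hyB, hyq⟩ : ∃ y ∈ B, y ≠ q := by
    by_contra! h'
    exact hnt.1 fun u hu v hv => (h' u hu).trans (h' v hv).symm
  have hmaps : ∀ z ∈ B, h z ∈ B := fun z hz => by
    rw [← hB.smul_eq_of_mem (g := ⟨h, hhK⟩) hqB (by change h q ∈ B; rwa [hq])]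
    exact ⟨z, hz, rfl⟩
  have hhy : h y ≠ y := fun h' => hh y hyq (by rw [h', h'])
  have hne : ∀ z ≠ q, h z ≠ q := fun z hz h' => hz (h.injective (h'.trans hq.symm))
  have h4 : ({q, y, h y, h (h y)} : Finset α).card = 4 := by
    have := hne _ hyq
    have := hne _ this
    have := hh y hyq
    have := h.injective.ne hhy
    grind
  have hsub : (({q, y, h y, h (h y)} : Finset α) : Set α) ⊆ B := by
    simp [Set.insert_subset_iff, hqB, hyB, hmaps]
  have hle : 4 ≤ B.ncard := by
    rw [← h4, ← Set.ncard_coe_finset]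
    exact Set.ncard_le_ncard hsub
  have hdvd := hB.ncard_dvd_card ⟨q, hqB⟩
  have hlt : B.ncard < 9 := hα ▸ (Set.ncard_lt_card hnt.2)
  rw [hα] at hdvd
  interval_cases B.ncard <;> omega

section DegreeTwelve

variable {α : Type*} [Fintype α] [DecidableEq α] {K : Subgroup (Equiv.Perm α)}

theorem exists_mem_map_pair_eq (hK : IsPretransitive K α) {c : Equiv.Perm α} (hcK : c ∈ K)
    (hc : c.IsCycle) (hcard : c.support.card + 1 = Fintype.card α) {a b a' b' : α} (hab : a ≠ b)
    (hab' : a' ≠ b') : ∃ k ∈ K, k a = a' ∧ k b = b' := by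
  obtain ⟨e, he⟩ : ∃ e, c.supportᶜ = {e} := Finset.card_eq_one.1 (by rw [Finset.card_compl]; omega)
  have hfix : ∀ y, c y = y ↔ y = e := fun y => by
    rw [← notMem_support, ← Finset.mem_compl, he, Finset.mem_singleton]
  obtain ⟨⟨k, hkK⟩, rfl⟩ := hK.exists_smul_eq a e
  obtain ⟨⟨l, hlK⟩, hl⟩ := hK.exists_smul_eq a' (k a)
  change l a' = k a at hl
  change ∀ y, c y = y ↔ y = k a at hfix
  obtain ⟨i, hi⟩ : ∃ i : ℤ, (c ^ i) (k b) = l b' :=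
    hc.exists_zpow_eq (fun h => hab (k.injective ((hfix _).1 h)).symm)
      fun h => hab' (l.injective (hl.trans ((hfix _).1 h).symm))
  refine ⟨l⁻¹ * c ^ i * k, K.mul_mem (K.mul_mem (K.inv_mem hlK) (K.zpow_mem hcK i)) hkK, ?_, ?_⟩
  · rw [mul_apply, mul_apply, zpow_apply_eq_self_of_apply_eq_self ((hfix _).2 rfl),
      inv_eq_iff_eq, hl]
  · rw [mul_apply, mul_apply, hi, inv_eq_iff_eq]

/-- After two points have been moved into the fixed point set of `c`, a conjugate of `w` that
fixes exactly these two points moves the third fixed point of `c` into the support of `c`. -/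
theorem exists_mem_map_eq_compl_support
    (hK : ∀ a b a' b' : α, a ≠ b → a' ≠ b' → ∃ k ∈ K, k a = a' ∧ k b = b') {c w : Equiv.Perm α}
    (hcK : c ∈ K) (hc : c.IsCycle) (hc3 : c.supportᶜ.card = 3) (hwK : w ∈ K)
    (hw2 : w.supportᶜ.card = 2) {T : Finset α} (hT : T.card = 3) :
    ∃ k ∈ K, T.map k.toEmbedding = c.supportᶜ := by
  obtain ⟨a, b, d, hab, had, hbd, rfl⟩ := Finset.card_eq_three.1 hT
  obtain ⟨p₁, p₂, p₃, h12, h13, h23, hP⟩ := Finset.card_eq_three.1 hc3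
  have hcfix : ∀ y, c y = y ↔ y = p₁ ∨ y = p₂ ∨ y = p₃ := fun y => by
    rw [← notMem_support, ← Finset.mem_compl, hP]; simp
  suffices ∃ k ∈ K, k a = p₁ ∧ k b = p₂ ∧ k d = p₃ by
    obtain ⟨k, hkK, rfl, rfl, rfl⟩ := this
    exact ⟨k, hkK, by rw [hP]; simp [Finset.map_insert]⟩
  obtain ⟨k, hkK, rfl, rfl⟩ := hK a b p₁ p₂ hab h12
  obtain ⟨u, v, huv, hUV⟩ := Finset.card_eq_two.1 hw2
  obtain ⟨l, hlK, rfl, rfl⟩ := hK (k a) (k b) u v h12 huv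
  have hwfix : ∀ y, w (l y) = l y ↔ y = k a ∨ y = k b := fun y => by
    rw [← notMem_support, ← Finset.mem_compl, hUV, Finset.mem_insert, Finset.mem_singleton,
      l.injective.eq_iff, l.injective.eq_iff]
  by_cases hd : k d = p₃
  · exact ⟨k, hkK, rfl, rfl, hd⟩
  set w' := l⁻¹ * w * l
  have hw'K : w' ∈ K := K.mul_mem (K.mul_mem (K.inv_mem hlK) hwK) hlK
  have hw'fix : ∀ y, w' y = y ↔ y = k a ∨ y = k b := fun y => by
    rw [mul_apply, mul_apply, inv_eq_iff_eq, hwfix]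
  have ha : w' (k a) = k a := (hw'fix _).2 (.inl rfl)
  have hb : w' (k b) = k b := (hw'fix _).2 (.inr rfl)
  have hkd : c (k d) ≠ k d := by
    rw [ne_eq, hcfix, k.injective.eq_iff, k.injective.eq_iff]
    exact fun h => h.elim had.symm fun h => h.elim hbd.symm hd
  have hp₃ : c (w' p₃) ≠ w' p₃ := by
    rw [ne_eq, hcfix, hw'fix]
    rintro (h | h | h)
    · exact h13 (w'.injective (ha.trans h.symm))
    · exact h23 (w'.injective (hb.trans h.symm))
    · exact h.elim h13.symm h23.symm
  obtain ⟨i, hi⟩ := hc.exists_zpow_eq hkd hp₃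
  have hci : ∀ y, c y = y → (c ^ i) y = y := fun y hy => zpow_apply_eq_self_of_apply_eq_self hy i
  refine ⟨w'⁻¹ * c ^ i * k, K.mul_mem (K.mul_mem (K.inv_mem hw'K) (K.zpow_mem hcK i)) hkK,
    ?_, ?_, ?_⟩
  · rw [mul_apply, mul_apply, hci _ ((hcfix _).2 (.inl rfl)), inv_eq_iff_eq, ha]
  · rw [mul_apply, mul_apply, hci _ ((hcfix _).2 (.inr (.inl rfl))), inv_eq_iff_eq, hb]
  · rw [mul_apply, mul_apply, hi, inv_eq_iff_eq]

theorem isPreprimitive_inducedGroup_support {c h : Equiv.Perm α} (hcK : c ∈ K) (hc : c.IsCycle)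
    (hc9 : c.support.card = 9) (hK : ∀ T : Finset α, T.card = 3 → ∃ k ∈ K,
      T.map k.toEmbedding = c.supportᶜ) (hhK : h ∈ K) (hh8 : h.support.card = 8)
    (hα : Fintype.card α = 12) (hh : ∀ y ∈ h.support, h (h y) ≠ y) :
    IsPreprimitive (inducedGroup K c.support) c.support := by
  obtain ⟨T, hT, hT3⟩ := Finset.exists_subset_card_eq (s := h.supportᶜ) (n := 3)
    (by rw [Finset.card_compl]; omega)
  obtain ⟨k, hkK, hk⟩ := hK T hT3
  have hh'K : k * h * k⁻¹ ∈ K := K.mul_mem (K.mul_mem hkK hhK) (K.inv_mem hkK)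
  have hsub : (k * h * k⁻¹).support ⊆ c.support := by
    rw [← Finset.compl_subset_compl, ← hk, support_conj]
    intro y hy
    obtain ⟨z, hz, rfl⟩ := Finset.mem_map.1 hy
    rw [Finset.mem_compl, Finset.mem_map']
    exact Finset.mem_compl.1 (hT hz)
  obtain ⟨q, hq⟩ := Finset.card_eq_one.1 (show (c.support \ (k * h * k⁻¹).support).card = 1 by
    rw [Finset.card_sdiff_of_subset hsub, card_support_conj, hc9, hh8])
  have hqc : q ∈ c.support \ (k * h * k⁻¹).support := hq ▸ Finset.mem_singleton_self q
  refine isPreprimitive_of_card_eq_nine (isPretransitive_inducedGroup_support hcK hc)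
    (by rw [Nat.card_eq_finsetCard, hc9])
    (subtypePerm_mem_inducedGroup hh'K (isInvariant_of_support_le hsub))
    (q := ⟨q, (Finset.mem_sdiff.1 hqc).1⟩)
    (Subtype.ext (notMem_support.1 (Finset.mem_sdiff.1 hqc).2)) fun y hy hhy => ?_
  have hmem : (y : α) ∈ (k * h * k⁻¹).support := by
    by_contra hy'
    exact hy (Subtype.ext (Finset.mem_singleton.1 (hq ▸ Finset.mem_sdiff.2 ⟨y.2, hy'⟩)))
  rw [support_conj] at hmem
  obtain ⟨z, hz, hzy⟩ := Finset.mem_map.1 hmem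
  have hfix : (k * h * k⁻¹) ((k * h * k⁻¹) y) = y := congrArg Subtype.val hhy
  rw [← hzy] at hfix
  exact hh z hz (k.injective (by simpa using hfix))

theorem card_support_subtypePerm {s : Finset α} {σ : Equiv.Perm α} (hσ : ∀ a, σ a ∈ s ↔ a ∈ s)
    (hs : sᶜ ⊆ σ.support) :
    (σ.subtypePerm hσ).support.card + sᶜ.card = σ.support.card := by
  have hmap : (σ.subtypePerm hσ).support.map (Function.Embedding.subtype _) = σ.support \ sᶜ := by
    ext a
    simp [and_comm]
  rw [← Finset.card_map, hmap, Finset.card_sdiff_add_card_eq_card hs]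

theorem exists_isThreeCycle_mem_inducedGroup {s : Finset α} {g : Equiv.Perm α}
    (hK : ∀ T : Finset α, T.card = 3 → ∃ k ∈ K, T.map k.toEmbedding = sᶜ) (hgK : g ∈ K)
    (hg6 : g.support.card = 6) (hg3 : g ^ 3 = 1) :
    ∃ τ ∈ inducedGroup K s, IsThreeCycle τ := by
  obtain ⟨u, hu⟩ : g.support.Nonempty := Finset.card_pos.1 (by omega)
  have hg3' : ∀ y, g (g (g y)) = y := fun y => DFunLike.congr_fun hg3 y
  have hgu : g u ≠ u := mem_support.1 hu
  have hggu : g (g u) ≠ u := fun h => hgu (by conv_rhs => rw [← hg3' u, h])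
  have hT3 : ({u, g u, g (g u)} : Finset α).card = 3 :=
    Finset.card_eq_three.2 ⟨_, _, _, hgu.symm, hggu.symm, (g.injective.ne hgu).symm, rfl⟩
  obtain ⟨k, hkK, hk⟩ := hK _ hT3
  have hmem : ∀ y, k y ∉ s ↔ y = u ∨ y = g u ∨ y = g (g u) := fun y => by
    rw [← Finset.mem_compl, ← hk]
    simp
  set g' := k * g * k⁻¹ with hg'
  have hg'k : ∀ y, g' (k y) = k (g y) := fun y => by simp [hg']
  have hs : ∀ a, g' a ∈ s ↔ a ∈ s := by
    refine k.surjective.forall.2 fun y => ?_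
    have hgy : g y = u ↔ y = g (g u) := by
      conv_lhs => rw [← hg3' u, g.injective.eq_iff]
    rw [hg'k, ← not_iff_not, hmem, hmem, g.injective.eq_iff, g.injective.eq_iff, hgy]
    tauto
  have hsub : sᶜ ⊆ g'.support := by
    rw [← hk, hg', support_conj, Finset.map_subset_map]
    simp [Finset.insert_subset_iff, mem_support.1 hu]
  refine ⟨g'.subtypePerm hs, subtypePerm_mem_inducedGroup
    (K.mul_mem (K.mul_mem hkK hgK) (K.inv_mem hkK)) hs, card_support_eq_three_iff.1 ?_⟩
  have hcard := card_support_subtypePerm hs hsub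
  have hg'6 : g'.support.card = 6 := by rw [hg', card_support_conj, hg6]
  rw [← hk, Finset.card_map, hT3, hg'6] at hcard
  omega

/-- The fixed points of the nine-cycle `c` can be moved into those of the square `h` of an
eight-cycle, which makes the group induced on `c.support` primitive, and onto an orbit of the
square `g` of a six-cycle, which provides it with a three-cycle. -/
theorem not_avoidsPrimeCycle_of_degree_twelve {K : Subgroup (Equiv.Perm (Fin 12))}
    (h11 : {1, 11} ∈ cycleTypes K) (h66 : {6, 6} ∈ cycleTypes K) (h10 : {10, 2} ∈ cycleTypes K)
    (h9 : {9, 1, 1, 1} ∈ cycleTypes K) (h8 : {8, 2, 1, 1} ∈ cycleTypes K)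
    (h6 : {6, 2, 2, 2} ∈ cycleTypes K) : ¬ AvoidsPrimeCycle 12 (cycleTypes K) := by
  intro hK
  have htr := isPretransitive_of_pair_mem h11 h66 (by simp) (by norm_num) (by norm_num)
  rw [Multiset.pair_comm] at h11
  obtain ⟨z, hzK, hz, hz11⟩ := exists_isCycle_mem_of_cons_mem_cycleTypes (q := 11) (s := {1})
    (by norm_num) (by simp) h11
  obtain ⟨c, hcK, hc, hc9⟩ := exists_isCycle_mem_of_cons_mem_cycleTypes (q := 9) (s := {1, 1, 1})
    (by norm_num) (by simp) h9
  obtain ⟨w, hw, hw10, hwK⟩ := exists_isCycle_pow_mem_of_cons_mem_cycleTypes (q := 10) (s := {2})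
    (by norm_num) h10 2 (by simp)
  obtain ⟨h, hh, hh8, hhK⟩ := exists_isCycle_pow_mem_of_cons_mem_cycleTypes (q := 8)
    (s := {2, 1, 1}) (by norm_num) h8 2 (by simp)
  obtain ⟨g, hg, hg6, hgK⟩ := exists_isCycle_pow_mem_of_cons_mem_cycleTypes (q := 6)
    (s := {2, 2, 2}) (by norm_num) h6 2 (by simp)
  have hsup : ∀ {σ : Equiv.Perm (Fin 12)} {m : ℕ}, σ.IsCycle → 0 < m → m < σ.support.card →
      (σ ^ m).support = σ.support := fun hσ h0 hm =>
    hσ.support_pow_of_pos_of_lt_orderOf h0 (hσ.orderOf ▸ hm)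
  have hmap : ∀ T : Finset (Fin 12), T.card = 3 → ∃ k ∈ K, T.map k.toEmbedding = c.supportᶜ :=
    fun T => exists_mem_map_eq_compl_support
      (fun _ _ _ _ => exists_mem_map_pair_eq htr hzK hz (by rw [hz11]; simp)) hcK hc
      (by rw [Finset.card_compl, hc9]; simp) hwK
      (by rw [Finset.card_compl, hsup hw (by omega) (by omega), hw10]; simp)
  have hprim := isPreprimitive_inducedGroup_support hcK hc hc9 hmap hhK
    (by rw [hsup hh (by omega) (by omega), hh8]) (by simp) fun y hy => by
      rw [← mul_apply, ← pow_add, ← mem_support, hsup hh (by omega) (by omega)]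
      rwa [hsup hh (by omega) (by omega)] at hy
  obtain ⟨τ, hτK, hτ⟩ := exists_isThreeCycle_mem_inducedGroup hmap hgK
    (by rw [hsup hg (by omega) (by omega), hg6])
    (by rw [← pow_mul, ← orderOf_dvd_iff_pow_eq_one, hg.orderOf, hg6])
  obtain ⟨d, hdK, hd, hd5⟩ := exists_isCycle_mem_of_alternatingGroup_le_inducedGroup (r := 5)
    (alternatingGroup_le_of_isPreprimitive_of_isThreeCycle_mem hprim hτ hτK) (by norm_num)
    (by decide) (by omega) (by rw [Finset.card_compl, hc9]; simp)
  exact AvoidsPrimeCycle.notMem_of_isCycle (by rwa [Fintype.card_fin]) hd (by rw [hd5]; norm_num)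
    (by rw [hd5]; simp) hdK

end DegreeTwelve

section DegreeNine

theorem conj_mem_zpowers_of_card_dvd_cube {G : Type*} [Group G] [Finite G] {p : ℕ}
    (hp : p.Prime) (hG : Nat.card G ∣ p ^ 3) {x : G} (hx : orderOf x = p ^ 2) (y : G) :
    y * x * y⁻¹ ∈ Subgroup.zpowers x := by
  have hcard := (Subgroup.zpowers x).card_mul_index
  rw [Nat.card_zpowers, hx] at hcard
  suffices (Subgroup.zpowers x).Normal from this.conj_mem x (Subgroup.mem_zpowers x) y
  have hidx : (Subgroup.zpowers x).index ∣ p := by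
    rw [← hcard, pow_succ] at hG
    exact Nat.dvd_of_mul_dvd_mul_left (pow_pos hp.pos 2) hG
  obtain h1 | h1 := (Nat.dvd_prime hp).1 hidx
  · rw [Subgroup.index_eq_one.1 h1]
    infer_instance
  · apply Subgroup.normal_of_index_eq_minFac_card
    rw [h1, ← hcard, h1, ← pow_succ, hp.pow_minFac (by norm_num)]

theorem card_dvd_of_forall_not_isThreeCycle {P : Subgroup (Equiv.Perm (Fin 9))}
    (hP : IsPGroup 3 P) (h3 : ∀ k ∈ P, ¬ IsThreeCycle k) : Nat.card P ∣ 3 ^ 3 := by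
  have : Fact (Nat.Prime 3) := ⟨Nat.prime_three⟩
  obtain ⟨k, hk⟩ := IsPGroup.iff_card.1 hP
  have hfac : (Nat.card (Equiv.Perm (Fin 9))).factorization 3 = 4 := by
    rw [Nat.card_perm, Nat.card_fin, show Nat.factorial 9 = 3 ^ 4 * 4480 from rfl,
      Nat.factorization_mul (by norm_num) (by norm_num), Nat.factorization_pow]
    simp [Nat.prime_three.factorization, Nat.factorization_eq_zero_of_not_dvd]
  have hk4 : k ≤ 4 := by
    rw [← hfac, ← Nat.prime_three.pow_dvd_iff_le_factorization Nat.card_pos.ne', ← hk]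
    exact Subgroup.card_subgroup_dvd_card P
  have hk_ne : k ≠ 4 := by
    rintro rfl
    have ht : IsThreeCycle (Equiv.swap (0 : Fin 9) 1 * Equiv.swap 0 2) :=
      isThreeCycle_swap_mul_swap_same (by decide) (by decide) (by decide)
    obtain ⟨g, hg⟩ := exists_conj_mem_sylow (Sylow.ofCard P (by rw [hk, hfac]))
      (IsPGroup.of_card (n := 1) (by rw [Nat.card_zpowers, ht.orderOf, pow_one]))
    refine h3 _ hg ?_
    rwa [IsThreeCycle, cycleType_conj]
  rw [hk]
  exact pow_dvd_pow 3 (by omega)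

section Affine

open scoped Fin.NatCast Fin.CommRing

theorem eq_add_mul_of_apply_add_one_eq {f : Fin 9 → Fin 9} {j : Fin 9}
    (hf : ∀ t, f (t + 1) = f t + j) (t : Fin 9) : f t = f 0 + j * t := by
  have hnat : ∀ n : ℕ, f (n : Fin 9) = f 0 + j * n := by
    intro n
    induction n with
    | zero => simp
    | succ n ih => rw [Nat.cast_succ, hf, ih]; ring
  simpa using hnat t.val

theorem prod_prod_Iio_iterate_affine_eq_one : ∀ j b : Fin 9,
    Function.Injective (fun n : Fin 9 => (fun t => b + j * t)^[n.val] 0) →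
    (∏ m : Fin 9, ∏ n ∈ Finset.Iio m, if (fun t => b + j * t)^[n.val] 0 <
      ((fun t => b + j * t)^[m.val] 0 : Fin 9) then 1 else -1) = (1 : ℤˣ) := by
  decide

theorem sign_eq_one_of_apply_add_one_eq {c : Equiv.Perm (Fin 9)} {b j : Fin 9} (h0 : c 0 = 0)
    (hc : ∀ t, c (t + 1) = b + j * c t) : sign c = 1 := by
  have hiter : ∀ n : ℕ, c (n : Fin 9) = (fun t => b + j * t)^[n] 0 := by
    intro n
    induction n with
    | zero => simpa using h0
    | succ n ih => rw [Function.iterate_succ_apply', ← ih, Nat.cast_succ, hc]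
  have hval : c = fun n : Fin 9 => (fun t => b + j * t)^[n.val] 0 := funext fun n => by
    rw [← hiter n.val, Fin.cast_val_eq_self]
  rw [sign_eq_prod_prod_Iio, hval]
  exact prod_prod_Iio_iterate_affine_eq_one j b (hval ▸ c.injective)

/-- A permutation `y` that normalizes the translations of `ℤ/9ℤ` is affine, so the permutation
`d` with `d (t + 1) = y (d t)` and `d 0 = 0` enumerates an orbit of an affine map. -/
theorem sign_eq_one_of_conj_finRotate {c : Equiv.Perm (Fin 9)}
    (h : (c * finRotate 9 * c⁻¹) * finRotate 9 * (c * finRotate 9 * c⁻¹)⁻¹ ∈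
      Subgroup.zpowers (finRotate 9)) : sign c = 1 := by
  obtain ⟨i, hi⟩ := Subgroup.mem_zpowers_iff.1 h
  obtain ⟨m, hm⟩ := (isCycle_finRotate_of_le (n := 9) (by norm_num)).exists_zpow_eq
    (x := 0) (y := c⁻¹ 0) (by decide) (by rw [finRotate_apply]; simp)
  set y := c * finRotate 9 * c⁻¹
  set d := c * finRotate 9 ^ m with hd
  have hzpow : ∀ t, (finRotate 9 ^ i) t = (finRotate 9 ^ i) 0 + t := fun t => by
    have hadd : ∀ t, (finRotate 9 ^ i) (t + 1) = (finRotate 9 ^ i) t + 1 := fun t => by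
      rw [← finRotate_apply, ← finRotate_apply, ← mul_apply, ← mul_apply,
        ((Commute.refl (finRotate 9)).zpow_left i).eq]
    rw [eq_add_mul_of_apply_add_one_eq hadd, one_mul]
  have hy : ∀ t, y (t + 1) = y t + (finRotate 9 ^ i) 0 := fun t => by
    have hcomm : y * finRotate 9 = finRotate 9 ^ i * y := by rw [hi, inv_mul_cancel_right]
    rw [← finRotate_apply, ← mul_apply, hcomm, mul_apply, hzpow (y t), add_comm]
  have hdy : ∀ t, d (t + 1) = y (d t) := fun t => by
    have hcomm : d * finRotate 9 = y * d := by
      rw [hd, mul_assoc, ← zpow_add_one, mul_assoc, inv_mul_cancel_left, mul_assoc,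
        ← zpow_one_add, add_comm]
    rw [← finRotate_apply, ← mul_apply, hcomm, mul_apply]
  have hsign : sign d = 1 := sign_eq_one_of_apply_add_one_eq
    (by rw [hd, mul_apply, hm]; exact c.apply_symm_apply 0)
    fun t => by rw [hdy, eq_add_mul_of_apply_add_one_eq hy]
  rwa [hd, Equiv.Perm.sign_mul, map_zpow, sign_finRotate, Even.neg_one_pow (by decide),
    one_zpow, mul_one] at hsign

end Affine

theorem sign_eq_one_of_conj_mem_zpowers {c x : Equiv.Perm (Fin 9)} (hx : x.cycleType = {9})
    (h : (c * x * c⁻¹) * x * (c * x * c⁻¹)⁻¹ ∈ Subgroup.zpowers x) : sign c = 1 := by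
  obtain ⟨g, rfl⟩ := isConj_iff.1 (isConj_of_cycleType_eq
    ((cycleType_finRotate_of_le (n := 9) (by norm_num)).trans hx.symm))
  obtain ⟨i, hi⟩ := Subgroup.mem_zpowers_iff.1 h
  have hconj : finRotate 9 ^ i = g⁻¹ * (g * finRotate 9 * g⁻¹) ^ i * g := by
    rw [conj_zpow]
    group
  have hsign : sign (g⁻¹ * c * g) = 1 := sign_eq_one_of_conj_finRotate
    (Subgroup.mem_zpowers_iff.2 ⟨i, by rw [hconj, hi]; group⟩)
  rwa [Equiv.Perm.sign_mul, Equiv.Perm.sign_mul, sign_inv, mul_right_comm, Int.units_mul_self,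
    one_mul] at hsign

/-- Sylow's theorem moves both nine-cycles into a three-group, whose order is at most twenty-seven
because it contains no three-cycle. -/
theorem sign_eq_one_of_conj_mem {H : Subgroup (Equiv.Perm (Fin 9))}
    (hH : H ≤ alternatingGroup (Fin 9)) (h3 : ∀ k ∈ H, ¬ IsThreeCycle k)
    {c x : Equiv.Perm (Fin 9)} (hx : x.cycleType = {9}) (hxH : x ∈ H) (hcx : c * x * c⁻¹ ∈ H) :
    sign c = 1 := by
  have : Fact (Nat.Prime 3) := ⟨Nat.prime_three⟩
  have hxo : orderOf x = 3 ^ 2 := by rw [← lcm_cycleType, hx]; rfl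
  have hcxo : orderOf (c * x * c⁻¹) = 3 ^ 2 := ((MulAut.conj c).orderOf_eq x).trans hxo
  have isPGroup_zpowers : ∀ z : H, orderOf (z : Equiv.Perm (Fin 9)) = 3 ^ 2 →
      IsPGroup 3 (Subgroup.zpowers z) := fun z hz =>
    IsPGroup.of_card (n := 2) (by rw [Nat.card_zpowers, ← hz, Subgroup.orderOf_coe])
  obtain ⟨Q, hQ⟩ := (isPGroup_zpowers ⟨x, hxH⟩ hxo).exists_le_sylow
  obtain ⟨h, hh⟩ := exists_conj_mem_sylow Q (isPGroup_zpowers ⟨_, hcx⟩ hcxo)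
  let P := Q.1.map H.subtype
  have hP : Nat.card P ∣ 3 ^ 3 := card_dvd_of_forall_not_isThreeCycle (Q.isPGroup'.map _) <| by
    rintro _ ⟨k, -, rfl⟩
    exact h3 _ k.2
  have hxP : x ∈ P := ⟨⟨x, hxH⟩, hQ (Subgroup.mem_zpowers _), rfl⟩
  have hyP : h * (c * x * c⁻¹) * h⁻¹ ∈ P := ⟨_, hh, rfl⟩
  obtain ⟨i, hi⟩ := conj_mem_zpowers_of_card_dvd_cube Nat.prime_three hP
    (x := ⟨x, hxP⟩) (by rw [Subgroup.orderOf_mk, hxo]) ⟨_, hyP⟩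
  have hsign := sign_eq_one_of_conj_mem_zpowers (c := h * c) hx
    ⟨i, by simpa [mul_assoc] using congrArg Subtype.val hi⟩
  rwa [Equiv.Perm.sign_mul, mem_alternatingGroup.1 (hH h.2), one_mul] at hsign

theorem exists_isThreeCycle_mem_of_nineCycles_covered {H : Subgroup (Equiv.Perm (Fin 9))}
    (hH : H ≤ alternatingGroup (Fin 9))
    (hcov : ∀ σ : Equiv.Perm (Fin 9), σ.cycleType = {9} →
      ∃ g ∈ alternatingGroup (Fin 9), g * σ * g⁻¹ ∈ H) : ∃ k ∈ H, IsThreeCycle k := by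
  by_contra! h3
  have hct : (finRotate 9).cycleType = {9} := cycleType_finRotate_of_le (by norm_num)
  obtain ⟨g₁, hg₁, hx⟩ := hcov (finRotate 9) hct
  obtain ⟨g₂, hg₂, hy⟩ := hcov (Equiv.swap 0 1 * finRotate 9 * (Equiv.swap 0 1)⁻¹)
    (by rw [cycleType_conj, hct])
  have hsign := sign_eq_one_of_conj_mem hH h3 (c := g₂ * Equiv.swap 0 1 * g₁⁻¹)
    (by rw [cycleType_conj, hct]) hx (by convert! hy using 1; group)
  rw [Equiv.Perm.sign_mul, Equiv.Perm.sign_mul, sign_inv, mem_alternatingGroup.1 hg₁,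
    mem_alternatingGroup.1 hg₂, sign_swap (by decide)] at hsign
  exact absurd hsign (by decide)

end DegreeNine

section Coverings

variable {G : Type*} [Group G]

theorem mem_map_conj_iff {H : Subgroup G} {g σ : G} :
    σ ∈ H.map (MulAut.conj g).toMonoidHom ↔ g⁻¹ * σ * g ∈ H := by
  constructor
  · rintro ⟨h, hh, rfl⟩
    simpa [mul_assoc] using hh
  · exact fun h => ⟨_, h, by simp [mul_assoc]⟩

theorem map_conj_ne_top {H : Subgroup G} (hH : H ≠ ⊤) (g : G) :
    H.map (MulAut.conj g).toMonoidHom ≠ ⊤ := by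
  refine fun h => hH ((Subgroup.eq_top_iff' H).2 fun x => ?_)
  have hx : g * x * g⁻¹ ∈ H.map (MulAut.conj g).toMonoidHom := h ▸ Subgroup.mem_top _
  simpa [mul_assoc] using mem_map_conj_iff.1 hx

theorem exists_conj_mem_of_isGroupCovering {H K : Subgroup G}
    (h : IsGroupCovering (conjugateSubgroups H ∪ conjugateSubgroups K)) (σ : G) :
    ∃ g : G, g * σ * g⁻¹ ∈ H ∨ g * σ * g⁻¹ ∈ K := by
  have hσ : σ ∈ ⋃ L ∈ conjugateSubgroups H ∪ conjugateSubgroups K, (L : Set G) :=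
    h.union_eq ▸ Set.mem_univ σ
  simp only [Set.mem_iUnion] at hσ
  obtain ⟨L, ⟨g, rfl⟩ | ⟨g, rfl⟩, hL⟩ := hσ
  · exact ⟨g⁻¹, Or.inl (by simpa using mem_map_conj_iff.1 hL)⟩
  · exact ⟨g⁻¹, Or.inr (by simpa using mem_map_conj_iff.1 hL)⟩

variable [Finite G]

theorem exists_forall_conj_notMem {H : Subgroup G} (hH : H ≠ ⊤) :
    ∃ σ : G, ∀ g : G, g * σ * g⁻¹ ∉ H := by
  classical
  have := Fintype.ofFinite G
  by_contra! h
  -- By Burnside's lemma the average number of fixed points on `G ⧸ H` is `1`, but every element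
  -- has a fixed point and the identity has more than one.
  have hburnside := sum_card_fixedBy_eq_card_orbits_mul_card_group G (G ⧸ H)
  have horbits : Fintype.card (Quotient (orbitRel G (G ⧸ H))) = 1 :=
    Fintype.card_eq_one_iff_nonempty_unique.2
      ((pretransitive_iff_unique_quotient_of_nonempty G (G ⧸ H)).1 inferInstance)
  rw [horbits, one_mul, ← Finset.card_univ, Finset.card_eq_sum_ones] at hburnside
  refine hburnside.not_gt (Finset.sum_lt_sum (fun σ _ => ?_) ⟨1, Finset.mem_univ _, ?_⟩)
  · obtain ⟨g, hg⟩ := h σ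
    refine Fintype.card_pos_iff.2 ⟨⟨QuotientGroup.mk g⁻¹, ?_⟩⟩
    rw [mem_fixedBy, Quotient.smul_mk, smul_eq_mul, eq_comm, QuotientGroup.eq]
    simpa [mul_assoc] using hg
  · obtain ⟨x, hx⟩ : ∃ x, x ∉ H := by
      by_contra! hall
      exact hH ((Subgroup.eq_top_iff' H).2 hall)
    refine Fintype.one_lt_card_iff.2
      ⟨⟨QuotientGroup.mk 1, by simp⟩, ⟨QuotientGroup.mk x, by simp⟩, fun heq => hx ?_⟩
    simpa using QuotientGroup.eq.1 (congrArg Subtype.val heq)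

theorem not_map_conj_le {H K : Subgroup G} (hK : K ≠ ⊤)
    (hcov : ∀ σ : G, (∃ g, g * σ * g⁻¹ ∈ H) ∨ ∃ g, g * σ * g⁻¹ ∈ K) (a b : G) :
    ¬ H.map (MulAut.conj a).toMonoidHom ≤ K.map (MulAut.conj b).toMonoidHom := by
  intro hle
  obtain ⟨σ, hσ⟩ := exists_forall_conj_notMem hK
  obtain ⟨g, hg⟩ := (hcov σ).resolve_right fun ⟨g, hg⟩ => hσ g hg
  have hmem : a * (g * σ * g⁻¹) * a⁻¹ ∈ H.map (MulAut.conj a).toMonoidHom :=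
    mem_map_conj_iff.2 (by simpa [mul_assoc] using hg)
  exact hσ (b⁻¹ * a * g) (by simpa [mul_assoc] using mem_map_conj_iff.1 (hle hmem))

theorem eq_of_map_conj_le {H : Subgroup G} {a b : G}
    (hle : H.map (MulAut.conj a).toMonoidHom ≤ H.map (MulAut.conj b).toMonoidHom) :
    H.map (MulAut.conj a).toMonoidHom = H.map (MulAut.conj b).toMonoidHom := by
  refine Subgroup.eq_of_le_of_card_ge hle (le_of_eq ?_)
  rw [Subgroup.card_map_of_injective (MulAut.conj b).injective,
    Subgroup.card_map_of_injective (MulAut.conj a).injective]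

theorem isStarStarCoverable_of_forall_exists_conj_mem {H K : Subgroup G} (hH : H ≠ ⊤)
    (hK : K ≠ ⊤) (hcov : ∀ σ : G, (∃ g, g * σ * g⁻¹ ∈ H) ∨ ∃ g, g * σ * g⁻¹ ∈ K) :
    IsStarStarCoverable G := by
  refine ⟨H, K, hH, hK, ?_, Set.eq_univ_iff_forall.2 fun σ => ?_, ?_⟩
  · rintro L (⟨g, rfl⟩ | ⟨g, rfl⟩)
    · exact map_conj_ne_top hH g
    · exact map_conj_ne_top hK g
  · simp only [Set.mem_iUnion]
    rcases hcov σ with ⟨g, hg⟩ | ⟨g, hg⟩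
    · exact ⟨_, Or.inl ⟨g⁻¹, rfl⟩, mem_map_conj_iff.2 (by simpa using hg)⟩
    · exact ⟨_, Or.inr ⟨g⁻¹, rfl⟩, mem_map_conj_iff.2 (by simpa using hg)⟩
  · rintro L (⟨a, rfl⟩ | ⟨a, rfl⟩) M (⟨b, rfl⟩ | ⟨b, rfl⟩) hne hle
    · exact hne (eq_of_map_conj_le hle)
    · exact not_map_conj_le hK hcov a b hle
    · exact not_map_conj_le hH (fun σ => (hcov σ).symm) a b hle
    · exact hne (eq_of_map_conj_le hle)

end Coverings

section SmallDegrees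

/-- The multisets of at most `f` integers `≥ 2` with sum at most `r`, as a list which may contain
the same multiset several times. -/
def boundedTypes : ℕ → ℕ → List (Multiset ℕ)
  | 0, _ => [0]
  | f + 1, r => 0 :: (List.range' 2 (r - 1)).flatMap fun a => (boundedTypes f (r - a)).map (a ::ₘ ·)

theorem mem_boundedTypes {f r : ℕ} {m : Multiset ℕ} (hm : ∀ x ∈ m, 2 ≤ x) (hr : m.sum ≤ r)
    (hf : m.card ≤ f) : m ∈ boundedTypes f r := by
  induction f generalizing r m with
  | zero => simp [boundedTypes, Multiset.card_eq_zero.1 (Nat.le_zero.1 hf)]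
  | succ f ih =>
    induction m using Multiset.induction with
    | empty => simp [boundedTypes]
    | cons a t _ =>
      rw [Multiset.sum_cons] at hr
      rw [Multiset.card_cons] at hf
      have ha := hm a (Multiset.mem_cons_self _ _)
      rw [boundedTypes, List.mem_cons, List.mem_flatMap]
      refine Or.inr ⟨a, ?_, List.mem_map.2 ⟨t, ?_, rfl⟩⟩
      · rw [List.mem_range'_1]; omega
      · exact ih (fun x hx => hm x (Multiset.mem_cons_of_mem hx)) (by omega) (by omega)

variable {n : ℕ}

theorem cycleType_mem_boundedTypes (σ : Equiv.Perm (Fin n)) :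
    σ.cycleType ∈ boundedTypes (n / 2) n := by
  have htwo : ∀ x ∈ σ.cycleType, 2 ≤ x := fun x hx => two_le_of_mem_cycleType hx
  have hsum : σ.cycleType.sum ≤ n := by simpa using sum_cycleType_le σ
  have hcard : σ.cycleType.card * 2 ≤ σ.cycleType.sum := by
    simpa using Multiset.card_nsmul_le_sum htwo
  exact mem_boundedTypes htwo hsum (by omega)

variable {α : Type*}

/-- The automorphism group of the ternary operation `m`. -/
def ternaryOperationAut (m : α → α → α → α) : Subgroup (Equiv.Perm α) where
  carrier := {σ | ∀ a b c, σ (m a b c) = m (σ a) (σ b) (σ c)}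
  mul_mem' {σ τ} hσ hτ a b c := by rw [mul_apply, hτ, hσ]; rfl
  one_mem' _ _ _ := rfl
  inv_mem' {σ} hσ a b c := by rw [inv_eq_iff_eq, hσ]; simp

variable [Fintype α] [DecidableEq α]

instance ternaryOperationAut.decidableMem (m : α → α → α → α) (σ : Equiv.Perm α) :
    Decidable (σ ∈ ternaryOperationAut m) :=
  inferInstanceAs (Decidable (∀ a b c, σ (m a b c) = m (σ a) (σ b) (σ c)))

theorem even_sum_add_card_cycleType {σ : Equiv.Perm α} (hσ : σ ∈ alternatingGroup α) :
    Even (σ.cycleType.sum + σ.cycleType.card) := by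
  rw [mem_alternatingGroup, sign_of_cycleType] at hσ
  exact (neg_one_pow_eq_one_iff_even (by decide)).1 hσ

/-- The subgroup `H` contains an element `ρ` of cycle type `m` and the conjugate of `ρ` by some odd
permutation `h`. The permutations of cycle type `m` form one or two classes under conjugation by
even permutations, and two such classes are exchanged by `h`, so `H` meets all of them. -/
def MeetsClasses (H : Subgroup (Equiv.Perm α)) (m : Multiset ℕ) : Prop :=
  ∃ ρ h : Equiv.Perm α, ρ.cycleType = m ∧ sign h = -1 ∧ ρ ∈ H ∧ h * ρ * h⁻¹ ∈ H

theorem MeetsClasses.exists_conj_mem {H : Subgroup (Equiv.Perm α)} {σ : Equiv.Perm α}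
    (hH : MeetsClasses H σ.cycleType) : ∃ g ∈ alternatingGroup α, g * σ * g⁻¹ ∈ H := by
  obtain ⟨ρ, h, hρ, hodd, hρH, hconj⟩ := hH
  obtain ⟨g, rfl⟩ := isConj_iff.1 (isConj_iff_cycleType_eq.2 hρ.symm)
  rcases Int.units_eq_one_or (sign g) with hg | hg
  · exact ⟨g, hg, hρH⟩
  · refine ⟨h * g, by rw [mem_alternatingGroup, Equiv.Perm.sign_mul, hg, hodd]; rfl, ?_⟩
    simpa only [mul_inv_rev, mul_assoc] using hconj

theorem isStarStarCoverable_alternatingGroup_of_meetsClasses {l : List (Multiset ℕ)}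
    {H K : Subgroup (Equiv.Perm (Fin n))} (hH : ∃ σ, sign σ = 1 ∧ σ ∉ H)
    (hK : ∃ σ, sign σ = 1 ∧ σ ∉ K)
    (hl : ∀ m ∈ boundedTypes (n / 2) n, Even (m.sum + m.card) → m ∈ l)
    (hcov : ∀ m ∈ l, MeetsClasses H m ∨ MeetsClasses K m) :
    IsStarStarCoverable (alternatingGroup (Fin n)) := by
  have hne : ∀ L : Subgroup (Equiv.Perm (Fin n)), (∃ σ, sign σ = 1 ∧ σ ∉ L) →
      L.subgroupOf (alternatingGroup (Fin n)) ≠ ⊤ := by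
    rintro L ⟨σ, hσ, hσL⟩ h
    exact hσL (Subgroup.subgroupOf_eq_top.1 h hσ)
  have hconj : ∀ (L : Subgroup (Equiv.Perm (Fin n))) (σ : alternatingGroup (Fin n)),
      MeetsClasses L σ.1.cycleType →
        ∃ g, g * σ * g⁻¹ ∈ L.subgroupOf (alternatingGroup (Fin n)) := fun L σ hL =>
    let ⟨g, hg, h⟩ := hL.exists_conj_mem
    ⟨⟨g, hg⟩, h⟩
  exact isStarStarCoverable_of_forall_exists_conj_mem (hne H hH) (hne K hK) fun σ =>
    (hcov _ (hl _ (cycleType_mem_boundedTypes σ.1) (even_sum_add_card_cycleType σ.2))).imp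
      (hconj H σ) (hconj K σ)

/-- The harmonic conjugate of `c` with respect to `a` and `b` on the projective line over the field
with five elements, the point at infinity being `5`. -/
def harmonicConjugate (a b c : Fin 6) : Fin 6 :=
  if a = b then c else
    let i := if a = 5 then b.val else if b = 5 then a.val else 3 * (a.val + b.val) % 5
    if c = 5 then Fin.ofNat 6 i else if c.val = i then 5 else Fin.ofNat 6 ((2 * i + 5 - c.val) % 5)

/-- The third point on the line through `a` and `b` in the Fano plane, where the point `a` is the
binary vector with value `a + 1`. -/
def fanoThirdPoint (a b : Fin 7) : Fin 7 :=
  if a = b then a else Fin.ofNat 7 (((a.val + 1) ^^^ (b.val + 1)) - 1)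

theorem isStarStarCoverable_alternatingGroup_four :
    IsStarStarCoverable (alternatingGroup (Fin 4)) := by
  -- `H` is dihedral of order `8`.
  refine isStarStarCoverable_alternatingGroup_of_meetsClasses
    (H := ternaryOperationAut fun a _ _ => a ^^^ 1) (K := stabilizer _ ({0} : Finset (Fin 4)))
    (l := [0, {2, 2}, {3}])
    ⟨c[1, 2, 3], by decide⟩ ⟨c[0, 1, 2], by decide⟩ (by decide) ?_
  simp only [List.forall_mem_cons, List.not_mem_nil, false_imp_iff, implies_true, and_true]
  exact ⟨.inr ⟨1, c[2, 3], by decide⟩,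
    .inl ⟨c[0, 1] * c[2, 3], c[2, 3], by decide⟩,
    .inr ⟨c[1, 2, 3], c[2, 3], by decide⟩⟩

theorem isStarStarCoverable_alternatingGroup_five :
    IsStarStarCoverable (alternatingGroup (Fin 5)) := by
  -- `H` is the affine group of the line over the field with five elements.
  refine isStarStarCoverable_alternatingGroup_of_meetsClasses
    (H := ternaryOperationAut fun a b c => a - b + c) (K := stabilizer _ ({0} : Finset (Fin 5)))
    (l := [0, {2, 2}, {3}, {5}])
    ⟨c[0, 1, 2], by decide⟩ ⟨c[0, 1, 2], by decide⟩ (by decide) ?_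
  simp only [List.forall_mem_cons, List.not_mem_nil, false_imp_iff, implies_true, and_true]
  exact ⟨.inr ⟨1, c[3, 4], by decide⟩,
    .inr ⟨c[1, 2] * c[3, 4], c[3, 4], by decide⟩,
    .inr ⟨c[1, 2, 3], c[3, 4], by decide⟩,
    .inl ⟨c[0, 1, 2, 3, 4], c[1, 2, 4, 3], by decide⟩⟩

theorem isStarStarCoverable_alternatingGroup_six :
    IsStarStarCoverable (alternatingGroup (Fin 6)) := by
  -- `H` is the projective linear group `PGL₂(5)`.
  refine isStarStarCoverable_alternatingGroup_of_meetsClasses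
    (H := ternaryOperationAut harmonicConjugate) (K := stabilizer _ ({0, 1} : Finset (Fin 6)))
    (l := [0, {2, 2}, {3}, {3, 3}, {4, 2}, {5}])
    ⟨c[0, 1, 2], by decide⟩ ⟨c[0, 1, 2], by decide⟩ (by decide) ?_
  simp only [List.forall_mem_cons, List.not_mem_nil, false_imp_iff, implies_true, and_true]
  exact ⟨.inr ⟨1, c[4, 5], by decide⟩,
    .inr ⟨c[0, 1] * c[2, 3], c[4, 5], by decide⟩,
    .inr ⟨c[2, 3, 4], c[4, 5], by decide⟩,
    .inl ⟨c[0, 1, 2] * c[3, 5, 4], c[2, 3], by decide⟩,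
    .inr ⟨c[0, 1] * c[2, 3, 4, 5], c[4, 5], by decide⟩,
    .inl ⟨c[0, 1, 2, 3, 4], c[2, 3, 4, 5], by decide⟩⟩

theorem isStarStarCoverable_alternatingGroup_seven :
    IsStarStarCoverable (alternatingGroup (Fin 7)) := by
  -- `H` is the collineation group of the Fano plane.
  refine isStarStarCoverable_alternatingGroup_of_meetsClasses
    (H := ternaryOperationAut fun a b _ => fanoThirdPoint a b)
    (K := stabilizer _ ({0, 1} : Finset (Fin 7)))
    (l := [0, {2, 2}, {3}, {3, 2, 2}, {3, 3}, {4, 2}, {5}, {7}])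
    ⟨c[0, 1, 2], by decide⟩ ⟨c[0, 1, 2], by decide⟩ (by decide) ?_
  simp only [List.forall_mem_cons, List.not_mem_nil, false_imp_iff, implies_true, and_true]
  exact ⟨.inr ⟨1, c[5, 6], by decide⟩,
    .inr ⟨c[0, 1] * c[2, 3], c[5, 6], by decide⟩,
    .inr ⟨c[2, 3, 4], c[5, 6], by decide⟩,
    .inr ⟨c[0, 1] * c[2, 3, 4] * c[5, 6], c[5, 6], by decide⟩,
    .inl ⟨c[0, 1, 2] * c[3, 4, 6], c[2, 4], by decide⟩,
    .inr ⟨c[0, 1] * c[2, 3, 4, 5], c[5, 6], by decide⟩,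
    .inr ⟨c[2, 3, 4, 5, 6], c[5, 6], by decide⟩,
    .inl ⟨c[0, 1, 3, 2, 5, 6, 4], c[2, 3, 4, 6], by decide⟩⟩

theorem isStarStarCoverable_alternatingGroup_eight :
    IsStarStarCoverable (alternatingGroup (Fin 8)) := by
  -- `H` is the affine group `AGL₃(2)`.
  refine isStarStarCoverable_alternatingGroup_of_meetsClasses
    (H := ternaryOperationAut fun a b c => a ^^^ b ^^^ c)
    (K := stabilizer _ ({0, 1, 2} : Finset (Fin 8)))
    (l := [0, {2, 2}, {2, 2, 2, 2}, {3}, {3, 2, 2}, {3, 3}, {4, 2}, {4, 4}, {5}, {5, 3},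
      {6, 2}, {7}])
    ⟨c[0, 1, 2], by decide⟩ ⟨c[0, 1, 3], by decide⟩ (by decide) ?_
  simp only [List.forall_mem_cons, List.not_mem_nil, false_imp_iff, implies_true, and_true]
  exact ⟨.inr ⟨1, c[6, 7], by decide⟩,
    .inr ⟨c[0, 1] * c[3, 4], c[6, 7], by decide⟩,
    .inl ⟨c[0, 1] * c[2, 3] * c[4, 6] * c[5, 7], c[6, 7], by decide⟩,
    .inr ⟨c[0, 1, 2], c[6, 7], by decide⟩,
    .inr ⟨c[0, 1, 2] * c[3, 5] * c[4, 7], c[6, 7], by decide⟩,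
    .inr ⟨c[0, 1, 2] * c[3, 4, 5], c[6, 7], by decide⟩,
    .inr ⟨c[0, 1] * c[3, 4, 7, 6], c[6, 7], by decide⟩,
    .inl ⟨c[0, 1, 2, 3] * c[4, 5, 6, 7], c[5, 7], by decide⟩,
    .inr ⟨c[3, 4, 5, 6, 7], c[6, 7], by decide⟩,
    .inr ⟨c[0, 1, 2] * c[3, 4, 5, 6, 7], c[6, 7], by decide⟩,
    .inl ⟨c[0, 1, 5, 2, 3, 7] * c[4, 6], c[5, 7], by decide⟩,
    .inl ⟨c[0, 2, 1, 4, 5, 3, 7], c[3, 4, 7, 5], by decide⟩⟩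

end SmallDegrees

section LargeDegrees

variable {n : ℕ}

/-- Every even permutation of `Fin n` has a conjugate, by an even permutation, in `H` or in `K`. -/
def CoversEvenPerms (H K : Subgroup (Equiv.Perm (Fin n))) : Prop :=
  ∀ σ ∈ alternatingGroup (Fin n), ∃ g ∈ alternatingGroup (Fin n),
    g * σ * g⁻¹ ∈ H ∨ g * σ * g⁻¹ ∈ K

theorem CoversEvenPerms.symm {H K : Subgroup (Equiv.Perm (Fin n))} (h : CoversEvenPerms H K) :
    CoversEvenPerms K H := fun σ hσ =>
  let ⟨g, hg, hmem⟩ := h σ hσ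
  ⟨g, hg, hmem.symm⟩

theorem coversEvenPerms_map_of_isGroupCovering {H K : Subgroup (alternatingGroup (Fin n))}
    (h : IsGroupCovering (conjugateSubgroups H ∪ conjugateSubgroups K)) :
    CoversEvenPerms (H.map (alternatingGroup (Fin n)).subtype)
      (K.map (alternatingGroup (Fin n)).subtype) := fun σ hσ =>
  let ⟨g, hg⟩ := exists_conj_mem_of_isGroupCovering h ⟨σ, hσ⟩
  ⟨g, g.2, hg.imp (fun hH => ⟨_, hH, rfl⟩) fun hK => ⟨_, hK, rfl⟩⟩

theorem map_subtype_lt_alternatingGroup {H : Subgroup (alternatingGroup (Fin n))} (hH : H ≠ ⊤) :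
    H.map (alternatingGroup (Fin n)).subtype < alternatingGroup (Fin n) := by
  refine lt_of_le_not_ge (Subgroup.map_subtype_le H) fun h => hH ?_
  refine (Subgroup.eq_top_iff' H).2 fun σ => ?_
  obtain ⟨τ, hτ, heq⟩ := h σ.2
  rwa [← Subtype.ext (a1 := τ) (a2 := σ) heq]

theorem CoversEvenPerms.coversEvenTypes {H K : Subgroup (Equiv.Perm (Fin n))}
    (h : CoversEvenPerms H K) : CoversEvenTypes n (cycleTypes H) (cycleTypes K) := by
  intro l hpos hsum heven
  obtain ⟨σ, hσ, rfl⟩ :=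
    exists_mem_alternatingGroup_parts_eq (α := Fin n) hpos (by simpa using hsum)
      (by simpa using heven)
  obtain ⟨g, -, hg⟩ := h σ hσ
  exact hg.imp parts_partition_mem_cycleTypes_of_conj_mem parts_partition_mem_cycleTypes_of_conj_mem

theorem not_hasPartialSum_of_degree_nine {H K : Subgroup (Equiv.Perm (Fin 9))}
    (hH : H ≤ alternatingGroup (Fin 9)) (hcov : CoversEvenPerms H K)
    (havoid : AvoidsPrimeCycle 9 (cycleTypes H)) {k : ℕ} (hk : k = 4 ∨ k = 5) :
    ¬ HasPartialSum (cycleTypes K) k := by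
  intro hsum
  have hnine : ∀ σ : Equiv.Perm (Fin 9), σ.cycleType = {9} →
      ∃ g ∈ alternatingGroup (Fin 9), g * σ * g⁻¹ ∈ H := by
    intro σ hσ
    obtain ⟨g, hg, h⟩ := hcov σ (by rw [mem_alternatingGroup, sign_of_cycleType, hσ]; rfl)
    refine ⟨g, hg, h.resolve_right fun hK => ?_⟩
    have hmem := parts_partition_mem_cycleTypes_of_conj_mem hK
    rw [parts_partition, ← sum_cycleType, hσ] at hmem
    have := eq_of_exists_le_singleton (hsum _ (by simpa using hmem))
    omega
  obtain ⟨t, htH, ht⟩ := exists_isThreeCycle_mem_of_nineCycles_covered hH hnine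
  exact AvoidsPrimeCycle.notMem_of_isCycle (by simpa using havoid) ht.isCycle
    (by rw [ht.card_support]; norm_num) (by simp [ht.card_support]) htH

theorem not_hasPartialSum_of_degree_ten {H K : Subgroup (Equiv.Perm (Fin 10))}
    (hcov : CoversEvenTypes 10 (cycleTypes H) (cycleTypes K))
    (havoid : AvoidsPrimeCycle 10 (cycleTypes H)) {k : ℕ} (hk : k = 3 ∨ k = 7) :
    ¬ HasPartialSum (cycleTypes K) k := by
  intro hsum
  refine not_avoidsPrimeCycle_of_degree_ten
    ((hcov.pair rfl 1 9).resolve_right fun h => ?_)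
    ((hcov.pair rfl 5 5).resolve_right fun h => ?_)
    ((hcov.pair rfl 4 6).resolve_right fun h => ?_) havoid
  all_goals
    have := eq_of_exists_le_pair (hsum _ h)
    omega

theorem not_hasPartialSum_of_degree_twelve {H K : Subgroup (Equiv.Perm (Fin 12))}
    (hcov : CoversEvenTypes 12 (cycleTypes H) (cycleTypes K))
    (havoid : AvoidsPrimeCycle 12 (cycleTypes H)) {k : ℕ} (hk : k = 5 ∨ k = 7) :
    ¬ HasPartialSum (cycleTypes K) k := by
  intro hsum
  refine not_avoidsPrimeCycle_of_degree_twelve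
    ((hcov.pair rfl 1 11).resolve_right fun h => ?_)
    ((hcov.pair rfl 6 6).resolve_right fun h => ?_)
    ((hcov.pair rfl 10 2).resolve_right fun h => ?_)
    ((hcov.quadruple rfl 9 1 1 1).resolve_right fun h => ?_)
    ((hcov.quadruple rfl 8 2 1 1).resolve_right fun h => ?_)
    ((hcov.quadruple rfl 6 2 2 2).resolve_right fun h => ?_) havoid
  iterate 3
    · have := eq_of_exists_le_pair (hsum _ h)
      omega
  iterate 3
    · have := eq_of_exists_le_quadruple (hsum _ h)
      omega

theorem CoversEvenPerms.pair_notMem_of_even {H K : Subgroup (Equiv.Perm (Fin n))}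
    (hcov : CoversEvenPerms H K) (hH : ¬ alternatingGroup (Fin n) ≤ H)
    (hK : ¬ alternatingGroup (Fin n) ≤ K) (heven : n % 2 = 0) (hn : 10 ≤ n) :
    {1, n - 1} ∉ cycleTypes H := by
  intro hpair
  have hH' : TypeTrichotomy n (cycleTypes H) := by simpa using typeTrichotomy_cycleTypes hH
  have hK' : TypeTrichotomy n (cycleTypes K) := by simpa using typeTrichotomy_cycleTypes hK
  obtain ⟨havoid, k, hsum, ⟨rfl, hk⟩ | ⟨rfl, hk⟩⟩ :=
    even_degree_exception hH' hK' hcov.coversEvenTypes heven hn hpair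
  · exact not_hasPartialSum_of_degree_ten hcov.coversEvenTypes havoid hk hsum
  · exact not_hasPartialSum_of_degree_twelve hcov.coversEvenTypes havoid hk hsum

theorem not_coversEvenPerms_of_even {H K : Subgroup (Equiv.Perm (Fin n))}
    (hH : ¬ alternatingGroup (Fin n) ≤ H) (hK : ¬ alternatingGroup (Fin n) ≤ K)
    (heven : n % 2 = 0) (hn : 10 ≤ n) : ¬ CoversEvenPerms H K := fun hcov =>
  (hcov.coversEvenTypes.pair heven 1 (n - 1)).elim
    (hcov.pair_notMem_of_even hH hK heven hn) (hcov.symm.pair_notMem_of_even hK hH heven hn)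

theorem not_coversEvenPerms_of_odd {H K : Subgroup (Equiv.Perm (Fin n))}
    (hH : H < alternatingGroup (Fin n)) (hK : K < alternatingGroup (Fin n))
    (hodd : n % 2 = 1) (hn : 9 ≤ n) : ¬ CoversEvenPerms H K := by
  intro hcov
  have hH' : TypeTrichotomy n (cycleTypes H) := by simpa using typeTrichotomy_cycleTypes hH.not_ge
  have hK' : TypeTrichotomy n (cycleTypes K) := by simpa using typeTrichotomy_cycleTypes hK.not_ge
  obtain ⟨rfl, ⟨havoid, k, hk, hsum⟩ | ⟨havoid, k, hk, hsum⟩⟩ :=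
    odd_degree_exception hH' hK' hcov.coversEvenTypes hodd hn
  · exact not_hasPartialSum_of_degree_nine hH.le hcov havoid hk hsum
  · exact not_hasPartialSum_of_degree_nine hK.le hcov.symm havoid hk hsum

theorem not_isStarStarCoverable_alternatingGroup_of_nine_le (hn : 9 ≤ n) :
    ¬ IsStarStarCoverable (alternatingGroup (Fin n)) := by
  rintro ⟨H, K, hH, hK, hδ⟩
  have hcov := coversEvenPerms_map_of_isGroupCovering hδ
  have hH' := map_subtype_lt_alternatingGroup hH
  have hK' := map_subtype_lt_alternatingGroup hK
  rcases Nat.mod_two_eq_zero_or_one n with heven | hodd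
  · exact not_coversEvenPerms_of_even hH'.not_ge hK'.not_ge heven (by omega) hcov
  · exact not_coversEvenPerms_of_odd hH' hK' hodd hn hcov

theorem not_isStarStarCoverable_of_forall_eq_bot_or_eq_top {G : Type*} [Group G]
    (hG : ∀ L : Subgroup G, L = ⊥ ∨ L = ⊤) : ¬ IsStarStarCoverable G := by
  rintro ⟨H, K, hH, hK, hδ⟩
  have hHbot : H = ⊥ := (hG H).resolve_right hH
  have hKbot : K = ⊥ := (hG K).resolve_right hK
  refine hH ((Subgroup.eq_top_iff' H).2 fun σ => ?_)
  obtain ⟨g, hg | hg⟩ := exists_conj_mem_of_isGroupCovering hδ σ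
  all_goals
    simp only [hHbot, hKbot, Subgroup.mem_bot, conj_eq_one_iff] at hg
    rw [hg]
    exact H.one_mem

theorem not_isStarStarCoverable_alternatingGroup_of_lt_four (hn : n < 4) :
    ¬ IsStarStarCoverable (alternatingGroup (Fin n)) := by
  refine not_isStarStarCoverable_of_forall_eq_bot_or_eq_top fun L => ?_
  rcases (by omega : n ≤ 2 ∨ n = 3) with hn | rfl
  · have : Subsingleton (alternatingGroup (Fin n)) := by
      interval_cases n <;> exact Fintype.card_le_one_iff_subsingleton.1 (by decide)
    exact Or.inl (Subsingleton.elim _ _)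
  · have : Fact (Nat.card (alternatingGroup (Fin 3))).Prime :=
      ⟨by rw [Nat.card_eq_fintype_card]; decide⟩
    exact L.eq_bot_or_eq_top_of_prime_card

end LargeDegrees

theorem theorem3p9 (n : ℕ) :
    IsStarStarCoverable (alternatingGroup (Fin n)) ↔ 4 ≤ n ∧ n ≤ 8 := by
  constructor
  · intro h
    constructor
    · by_contra! hn
      exact not_isStarStarCoverable_alternatingGroup_of_lt_four hn h
    · by_contra! hn
      exact not_isStarStarCoverable_alternatingGroup_of_nine_le hn h
  · rintro ⟨h4, h8⟩
    interval_cases n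
    · exact isStarStarCoverable_alternatingGroup_four
    · exact isStarStarCoverable_alternatingGroup_five
    · exact isStarStarCoverable_alternatingGroup_six
    · exact isStarStarCoverable_alternatingGroup_seven
    · exact isStarStarCoverable_alternatingGroup_eight
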